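/- Graphs are finite, and may have multiple edges. For a graph $G=(V,E)$, a complex number $q$ and complex edge weights $\mathbf v=\{v_e\}_{e\in E}$, the multivariate Tutte polynomial is $$Z_G(q,\mathbf v)=\sum_{A\subseteq E} q^{k(A)}\prod_{e\in A}v_e,$$ where $k(A)$ is the number of connected components of $(V,A)$. For distinct vertices $x,y$ let $\lambda_G(x,y)$ be the maximum number of edge-disjoint paths from $x$ to $y$; the maxmaxflow of $G$ is $\max_{x\ne y}\lambda_G(x,y)$ (taken to be $0$ if $G$ has at most one vertex). A loopless graph is series-parallel if it can be obtained from a forest by a finite (possibly empty) sequence of series and parallel extensions, i.e. of replacements of an edge by two edges in series or by two edges in parallel. **Theorem 7.1.** Fix an integer $\Lambda\ge 2$, and let $G=(V,E)$ be a loopless series-parallel graph of maxmaxflow at most $\Lambda$. If $\Lambda\ge3$, let $\rho^\star_\Lambda$ be the unique solution (it exists and is unique) of $$(1+\rho)^\Lambda = 2(1+\rho^2)^{\Lambda-1}$$ in the open interval $(0,1)$; and let $\rho^\star_2=1$. Then $Z_G(q,\mathbf v)\neq 0$ whenever $q\in\mathbb C$ satisfies $|q-1|\ge 1/\rho^\star_\Lambda$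 (with $\ge$ replaced by $>$ when $\Lambda=2$) and each of the complex edge weights $v_e$, $e\in E$, satisfies $$v_e\in[-1,0]\qquad\text{or}\qquad \left( q+v_e\neq0 \ \text{ and }\ \left|\frac{v_e}{q+v_e}\right|\le \rho\,\frac{X-1}{1-\rho X}\right)$$ (with strict inequality in the second alternative when $\Lambda=2$), where $$\rho=\frac1{|q-1|}\qquad\text{and}\qquad X=\left(\frac{2}{1+\rho}\right)^{1/(\Lambda-1)}.$$ -/

import Mathlib

namespace Graph

variable {α β : Type*}

/-- The number `k(A)` of connected components of the spanning subgraph `(V, A)` of `G = (V, E)`.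
(Loops and edge multiplicities, which `toSimpleGraph` forgets, do not affect components.) -/
noncomputable def numComponents (G : Graph α β) (A : Set β) : ℕ :=
  Nat.card (G.restrict A).toSimpleGraph.ConnectedComponent

/-- The multivariate Tutte polynomial `Z_G(q, v) = ∑_{A ⊆ E} q ^ k(A) ∏_{e ∈ A} v_e` of a graph
with finitely many edges, as a function of complex variables. Only the values of `v` on the edges
of `G` matter. -/
noncomputable def multivariateTutte (G : Graph α β) (hE : G.edgeSet.Finite) (q : ℂ) (v : β → ℂ) :
    ℂ :=
  ∑ A ∈ hE.toFinset.powerset, q ^ G.numComponents (A : Set β) * ∏ e ∈ A, v e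

/-- `G.IsPath x y S P`: there is a path in `G` from `x` to `y` (without repeated vertices)
whose set of vertices is `S` and whose set of edges is `P`. -/
inductive IsPath (G : Graph α β) : α → α → Set α → Set β → Prop
  | nil (x : α) (hx : x ∈ G.vertexSet) : IsPath G x x {x} ∅
  | cons (e : β) (x y z : α) (S : Set α) (P : Set β) (he : G.IsLink e x y)
      (hP : IsPath G y z S P) (hx : x ∉ S) : IsPath G x z (insert x S) (insert e P)

/-- `G` has `k` pairwise edge-disjoint paths from `x` to `y`. -/
def HasEdgeDisjointPaths (G : Graph α β) (x y : α) (k : ℕ) : Prop :=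
  ∃ P : Fin k → Set β, (∀ i, ∃ S : Set α, G.IsPath x y S (P i)) ∧
    Pairwise fun i j => Disjoint (P i) (P j)

/-- The maximum flow `λ_G(x, y)` between distinct vertices `x` and `y`:
the maximum number of edge-disjoint paths from `x` to `y`. -/
noncomputable def maxFlow (G : Graph α β) (x y : α) : ℕ∞ :=
  ⨆ (k : ℕ) (_ : G.HasEdgeDisjointPaths x y k), (k : ℕ∞)

/-- The maxmaxflow of `G`: the maximum of `λ_G(x, y)` over all pairs of distinct vertices. -/
noncomputable def maxmaxflow (G : Graph α β) : ℕ∞ :=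
  ⨆ (x ∈ G.vertexSet) (y ∈ G.vertexSet) (_ : x ≠ y), G.maxFlow x y

/-- A forest: a graph without cycles (a loop is a cycle of length one, a pair of parallel edges
a cycle of length two). It need not be connected. -/
structure IsForest (G : Graph α β) : Prop where
  simple : G.Simple
  acyclic : G.toSimpleGraph.IsAcyclic

/-- `H` is obtained from `G` by replacing an edge `e` by two edges in parallel.
One of the two new edges keeps the name `e`, the other one is called `f`. -/
def IsParallelExtension (G H : Graph α β) : Prop :=
  ∃ (e f : β) (x y : α), G.IsLink e x y ∧ f ∉ G.edgeSet ∧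
    H.vertexSet = G.vertexSet ∧
    ∀ e' a b, H.IsLink e' a b ↔ G.IsLink e' a b ∨ (e' = f ∧ s(a, b) = s(x, y))

/-- `H` is obtained from `G` by replacing an edge `e` with ends `x, y` by two edges in series:
a new vertex `w` is added, and `e` is replaced by an edge from `x` to `w`, which keeps the
name `e`, and a new edge `f` from `w` to `y`. -/
def IsSeriesExtension (G H : Graph α β) : Prop :=
  ∃ (e f : β) (x y w : α), G.IsLink e x y ∧ f ∉ G.edgeSet ∧ w ∉ G.vertexSet ∧
    H.vertexSet = insert w G.vertexSet ∧
    ∀ e' a b, H.IsLink e' a b ↔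
      (G.IsLink e' a b ∧ e' ≠ e) ∨ (e' = e ∧ s(a, b) = s(x, w)) ∨ (e' = f ∧ s(a, b) = s(w, y))

/-- A (loopless) graph is series-parallel if it can be obtained from a forest by a finite,
possibly empty, sequence of series and parallel extensions of edges. -/
inductive IsSeriesParallel : Graph α β → Prop
  | forest (G : Graph α β) (hG : G.IsForest) : IsSeriesParallel G
  | parallel (G H : Graph α β) (hG : IsSeriesParallel G) (h : G.IsParallelExtension H) :
      IsSeriesParallel H
  | series (G H : Graph α β) (hG : IsSeriesParallel G) (h : G.IsSeriesExtension H) :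
      IsSeriesParallel H

end Graph

/-- `ρ` is the number `ρ⋆_Λ`: it is `1` if `Λ = 2`, and if `Λ ≥ 3` it is a solution of
`(1 + ρ) ^ Λ = 2 (1 + ρ ^ 2) ^ (Λ - 1)` in the open interval `(0, 1)`. -/
def IsRhoStar (Λ : ℕ) (ρ : ℝ) : Prop :=
  (Λ = 2 ∧ ρ = 1) ∨
    (3 ≤ Λ ∧ 0 < ρ ∧ ρ < 1 ∧ (1 + ρ) ^ Λ = 2 * (1 + ρ ^ 2) ^ (Λ - 1))

/-- The radius `ρ (X - 1) / (1 - ρ X)`, where `X = (2 / (1 + ρ)) ^ (1 / (Λ - 1))`. -/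
noncomputable def transmissivityRadius (Λ : ℕ) (ρ : ℝ) : ℝ :=
  let X : ℝ := (2 / (1 + ρ)) ^ (1 / ((Λ : ℝ) - 1))
  ρ * ((X - 1) / (1 - ρ * X))

/-- The edge weight `v` is real antiferromagnetic: `-1 ≤ v ≤ 0`. -/
def IsRealAntiferromagnetic (v : ℂ) : Prop :=
  ∃ a : ℝ, v = (a : ℂ) ∧ -1 ≤ a ∧ a ≤ 0

/-- The transmissivity `v / (q + v)` is finite (that is, `q + v ≠ 0`) and satisfies
`|v / (q + v)| ≤ r`, with strict inequality when `Λ = 2`. -/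
def TransmissivityBound (Λ : ℕ) (q v : ℂ) (r : ℝ) : Prop :=
  q + v ≠ 0 ∧ ‖v / (q + v)‖ ≤ r ∧ (Λ = 2 → ‖v / (q + v)‖ < r)

/-! The graph is dismantled by undoing its extensions. Each undone step merges two edges into one
with an effective weight, until a forest remains, for which `Z` is a power of `q` times the product
of the factors `q + v_e`. What has to be controlled is the effective weights. Each edge carries a
pair `(a, b)` with `v = b / a`, so that merging needs no division, and a capacity, initially 1,
chosen so that flows stay bounded by `Λ`.

Put `Q = q - 1` and `ρ = 1 / |Q|`. The transmissivity `t = v / (q + v)` is multiplicative in series,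
and `1 + v = (1 + Q t) / (1 - t)` is multiplicative in parallel. A weight of capacity `k` is kept in
the disc `|t| ≤ R k`, with `R` the function `flowRadius`. In parallel, capacities add, and `R` is
designed so that the triangle inequality yields `R (k + l)` (`flowRadius_add`). In series, both
radii are at most `ρ` and the capacity is reset to 1, so `ρ ^ 2 ≤ R 1` is needed; this is the
inequality behind `ρ⋆` (`sq_le_flowRadius_one`).

Radii are at most `ρ` for capacities below `Λ`, and this is where maxmaxflow enters: an edge with a
detour around it has capacity less than `Λ` (`FlowLE.capacity_lt`). A bridge may reach capacity `Λ`,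
but of a bridge only `q + v ≠ 0` is required.

A weight in `[-1, 0]` makes `1 + v` a scaling factor in `[0, 1]`. Such factors pass through parallel
compositions, and are absorbed by the disc of radius `ρ`, which is closed under these scalings
(`transmissivity_real_mul_le`). -/

namespace Graph

variable {α β : Type*}

/-! ### Connectedness by edge sets, and counting components -/

/-- `x` and `y` are joined by edges of `G` that belong to `A` (or are equal). -/
def Conn (G : Graph α β) (A : Set β) : α → α → Prop :=
  Relation.EqvGen fun a b => ∃ e ∈ A, G.IsLink e a b

namespace Conn

variable {G H : Graph α β} {A B : Set β} {x y z : α} {e : β}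

lemma refl (x : α) : G.Conn A x x := Relation.EqvGen.refl x

lemma symm (h : G.Conn A x y) : G.Conn A y x := Relation.EqvGen.symm _ _ h

lemma trans (h : G.Conn A x y) (h' : G.Conn A y z) : G.Conn A x z :=
  Relation.EqvGen.trans _ _ _ h h'

lemma of_isLink (he : e ∈ A) (h : G.IsLink e x y) : G.Conn A x y :=
  Relation.EqvGen.rel _ _ ⟨e, he, h⟩

lemma lift {γ : Type*} {s : γ → γ → Prop} (hs : Equivalence s) (p : α → γ)
    (hp : ∀ e ∈ A, ∀ a b, G.IsLink e a b → s (p a) (p b)) (h : G.Conn A x y) : s (p x) (p y) := by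
  induction h with
  | rel a b h => obtain ⟨e, he, h⟩ := h; exact hp e he a b h
  | refl a => exact hs.refl _
  | symm a b _ ih => exact hs.symm ih
  | trans a b c _ _ ih ih' => exact hs.trans ih ih'

lemma equivalence (G : Graph α β) (A : Set β) : Equivalence (G.Conn A) :=
  Relation.EqvGen.is_equivalence _

lemma map (p : α → α) (hp : ∀ e ∈ A, ∀ a b, G.IsLink e a b → H.Conn B (p a) (p b))
    (h : G.Conn A x y) : H.Conn B (p x) (p y) :=
  lift (equivalence H B) p hp h

lemma of_forall (hp : ∀ e ∈ A, ∀ a b, G.IsLink e a b → H.Conn B a b)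
    (h : G.Conn A x y) : H.Conn B x y :=
  map id hp h

lemma mono (hAB : A ⊆ B) (h : G.Conn A x y) : G.Conn B x y :=
  of_forall (fun _ he _ _ hl => of_isLink (hAB he) hl) h

/-- `Conn` lives on all of `α`, and a point outside the vertex set is related only to itself; hence
the first alternative. -/
lemma eq_or_reachable {S : SimpleGraph G.vertexSet}
    (hS : ∀ e ∈ A, ∀ (a b : G.vertexSet), G.IsLink e a b → S.Reachable a b)
    (h : G.Conn A x y) :
    x = y ∨ ∃ (hx : x ∈ G.vertexSet) (hy : y ∈ G.vertexSet), S.Reachable ⟨x, hx⟩ ⟨y, hy⟩ := by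
  refine lift (s := fun x y => x = y ∨ ∃ (hx : x ∈ G.vertexSet) (hy : y ∈ G.vertexSet),
    S.Reachable ⟨x, hx⟩ ⟨y, hy⟩) ⟨fun _ => Or.inl rfl, ?_, ?_⟩ id ?_ h
  · rintro x y (rfl | ⟨hx, hy, h⟩)
    · exact Or.inl rfl
    · exact Or.inr ⟨hy, hx, h.symm⟩
  · rintro x y z (rfl | ⟨hx, hy, h⟩) (rfl | ⟨hy', hz, h'⟩)
    · exact Or.inl rfl
    · exact Or.inr ⟨hy', hz, h'⟩
    · exact Or.inr ⟨hx, hy, h⟩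
    · exact Or.inr ⟨hx, hz, h.trans h'⟩
  · intro e he a b hl
    exact Or.inr ⟨hl.left_mem, hl.right_mem, hS e he ⟨a, hl.left_mem⟩ ⟨b, hl.right_mem⟩ hl⟩

lemma left_mem_of_ne (h : G.Conn A x y) (hxy : x ≠ y) : x ∈ G.vertexSet := by
  have : x = y ∨ (x ∈ G.vertexSet ∧ y ∈ G.vertexSet) := by
    refine lift (s := fun x y => x = y ∨ (x ∈ G.vertexSet ∧ y ∈ G.vertexSet))
      ⟨fun _ => Or.inl rfl, ?_, ?_⟩ id (fun e _ a b hl => Or.inr ⟨hl.left_mem, hl.right_mem⟩) h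
    · rintro x y (rfl | h)
      exacts [Or.inl rfl, Or.inr h.symm]
    · rintro x y z (rfl | h) (rfl | h')
      exacts [Or.inl rfl, Or.inr h', Or.inr h, Or.inr ⟨h.1, h'.2⟩]
  exact (this.resolve_left hxy).1

lemma iff_reachable {S : SimpleGraph G.vertexSet}
    (hS : ∀ a b : G.vertexSet, S.Adj a b ↔ a ≠ b ∧ ∃ e ∈ A, G.IsLink e a b) (x y : G.vertexSet) :
    G.Conn A x y ↔ S.Reachable x y := by
  constructor
  · intro h
    have hr : ∀ e ∈ A, ∀ a b : G.vertexSet, G.IsLink e a b → S.Reachable a b := by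
      intro e he a b hl
      by_cases hab : a = b
      · rw [hab]
      · exact ((hS a b).2 ⟨hab, e, he, hl⟩).reachable
    rcases eq_or_reachable hr h with h | ⟨_, _, h⟩
    · rw [Subtype.ext h]
    · exact h
  · rintro ⟨p⟩
    induction p with
    | nil => exact refl _
    | cons h p ih =>
      obtain ⟨_, e, he, hl⟩ := (hS _ _).1 h
      exact (of_isLink he hl).trans ih

lemma iff_reachable_restrict (x y : G.vertexSet) :
    G.Conn A x y ↔ SimpleGraph.Reachable (V := G.vertexSet) (G.restrict A).toSimpleGraph x y := by
  refine iff_reachable (fun a b => ?_) x y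
  refine (toSimpleGraph_adj (G.restrict A) a b).to_iff.trans (and_congr Iff.rfl ?_)
  exact exists_congr fun e => (restrict_isLink ..).to_iff.trans (by tauto)

end Conn

/-- Any labelling whose fibres are the classes will do. Below, components of `G` are counted with
labels coming from an extension `H`. -/
lemma numComponents_eq_ncard_image {γ : Type*} (G : Graph α β) (A : Set β) (f : α → γ)
    (hf : ∀ x ∈ G.vertexSet, ∀ y ∈ G.vertexSet, f x = f y ↔ G.Conn A x y) :
    G.numComponents A = (f '' G.vertexSet).ncard := by
  rw [numComponents, ← Nat.card_coe_set_eq]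
  let g : (G.restrict A).toSimpleGraph.ConnectedComponent → f '' G.vertexSet :=
    Quot.lift (fun x : G.vertexSet => ⟨f x, x, x.2, rfl⟩) fun x y h =>
      Subtype.ext ((hf x x.2 y y.2).2 ((Conn.iff_reachable_restrict (G := G) x y).2 h))
  refine Nat.card_eq_of_bijective g ⟨?_, ?_⟩
  · rintro ⟨x⟩ ⟨y⟩ h
    exact Quot.sound ((Conn.iff_reachable_restrict (G := G) x y).1
      ((hf x x.2 y y.2).1 (congrArg Subtype.val h)))
  · rintro ⟨_, x, hx, rfl⟩
    exact ⟨Quot.mk _ ⟨x, hx⟩, rfl⟩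

/-- The class of `x` with respect to connectedness by edges in `A`. -/
def connClass (G : Graph α β) (A : Set β) (x : α) : Quotient ⟨G.Conn A, Conn.equivalence G A⟩ :=
  Quotient.mk _ x

lemma connClass_eq_iff {G : Graph α β} {A : Set β} {x y : α} :
    G.connClass A x = G.connClass A y ↔ G.Conn A x y :=
  Quotient.eq (r := ⟨G.Conn A, Conn.equivalence G A⟩)

lemma numComponents_eq_ncard_connClass (G : Graph α β) (A : Set β) :
    G.numComponents A = (G.connClass A '' G.vertexSet).ncard :=
  numComponents_eq_ncard_image G A _ fun _ _ _ _ => connClass_eq_iff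

lemma numComponents_congr {G H : Graph α β} {A B : Set β} (hV : H.vertexSet = G.vertexSet)
    (h : ∀ x ∈ G.vertexSet, ∀ y ∈ G.vertexSet, H.Conn B x y ↔ G.Conn A x y) :
    H.numComponents B = G.numComponents A := by
  rw [numComponents_eq_ncard_connClass G A, ← hV]
  refine numComponents_eq_ncard_image H B _ fun x hx y hy => ?_
  rw [connClass_eq_iff, h x (hV ▸ hx) y (hV ▸ hy)]

lemma numComponents_insert_isolated {G H : Graph α β} {A B : Set β} {w : α}
    (hfin : G.vertexSet.Finite) (hV : H.vertexSet = insert w G.vertexSet)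
    (h : ∀ x ∈ G.vertexSet, ∀ y ∈ G.vertexSet, H.Conn B x y ↔ G.Conn A x y)
    (hw : ∀ x ∈ G.vertexSet, ¬ H.Conn B x w) :
    H.numComponents B = G.numComponents A + 1 := by
  rw [numComponents_eq_ncard_connClass H B, hV, Set.image_insert_eq,
    Set.ncard_insert_of_notMem _ (hfin.image _), numComponents_eq_ncard_image G A (H.connClass B)]
  · intro x hx y hy
    rw [connClass_eq_iff, h x hx y hy]
  · rintro ⟨x, hx, hxw⟩
    exact hw x hx (connClass_eq_iff.1 hxw)

lemma numComponents_insert_of_conn {G H : Graph α β} {A B : Set β} {w x : α}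
    (hV : H.vertexSet = insert w G.vertexSet)
    (h : ∀ x ∈ G.vertexSet, ∀ y ∈ G.vertexSet, H.Conn B x y ↔ G.Conn A x y)
    (hx : x ∈ G.vertexSet) (hw : H.Conn B x w) :
    H.numComponents B = G.numComponents A := by
  rw [numComponents_eq_ncard_connClass H B, hV, Set.image_insert_eq, Set.insert_eq_of_mem,
    numComponents_eq_ncard_image G A (H.connClass B)]
  · intro x hx y hy
    rw [connClass_eq_iff, h x hx y hy]
  · exact ⟨x, hx, connClass_eq_iff.2 hw⟩

lemma numComponents_empty (G : Graph α β) : G.numComponents ∅ = G.vertexSet.ncard := by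
  rw [numComponents_eq_ncard_image G ∅ id, Set.image_id]
  intro x _ y _
  refine ⟨fun h => by cases h; exact Conn.refl _, fun h => ?_⟩
  exact Conn.lift (s := Eq) ⟨fun _ => rfl, Eq.symm, Eq.trans⟩ id (fun e he => he.elim) h

lemma numComponents_insert_bridge {G : Graph α β} {A : Set β} {e : β} {x y : α}
    (hfin : G.vertexSet.Finite) (he : G.IsLink e x y) (hxy : ¬ G.Conn A x y) :
    G.numComponents (insert e A) + 1 = G.numComponents A := by
  classical
  let f := G.connClass A
  -- The bridge fuses the class of `y` into that of `x`, so exactly the label `f y` is lost.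
  let g : α → _ := fun a => if f a = f y then f x else f a
  have hne : f x ≠ f y := fun h => hxy (connClass_eq_iff.1 h)
  have hmem : f y ∈ f '' G.vertexSet := ⟨y, he.right_mem, rfl⟩
  rw [numComponents_eq_ncard_connClass G A, ← Set.ncard_sdiff_singleton_add_one hmem (hfin.image _),
    numComponents_eq_ncard_image G (insert e A) g]
  · congr 2
    ext c
    constructor
    · rintro ⟨a, ha, rfl⟩
      by_cases h : f a = f y
      · simp only [g, h, if_true]
        exact ⟨⟨x, he.left_mem, rfl⟩, hne⟩
      · simp only [g, h, if_false]
        exact ⟨⟨a, ha, rfl⟩, h⟩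
    · rintro ⟨⟨a, ha, rfl⟩, h⟩
      exact ⟨a, ha, if_neg h⟩
  · have hex : G.Conn (insert e A) x y := Conn.of_isLink (Set.mem_insert _ _) he
    have hmono {a b : α} (h : f a = f b) : G.Conn (insert e A) a b :=
      (connClass_eq_iff.1 h).mono (Set.subset_insert _ _)
    intro a _ b _
    constructor
    · intro h
      by_cases h1 : f a = f y <;> by_cases h2 : f b = f y <;> simp only [g, h1, h2, if_true,
        if_false] at h
      · exact hmono (h1.trans h2.symm)
      · exact (hmono h1).trans (hex.symm.trans (hmono h))
      · exact (hmono h).trans (hex.trans (hmono h2.symm))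
      · exact hmono h
    · refine Conn.lift (s := Eq) ⟨fun _ => rfl, Eq.symm, Eq.trans⟩ g ?_
      rintro e' (rfl | he') a b hl
      · have gx : g x = f x := if_neg hne
        have gy : g y = f x := if_pos rfl
        rcases hl.eq_and_eq_or_eq_and_eq he with ⟨rfl, rfl⟩ | ⟨rfl, rfl⟩
        exacts [gx.trans gy.symm, gy.trans gx.symm]
      · have : f a = f b := connClass_eq_iff.2 (Conn.of_isLink he' hl)
        simp only [g, this]

/-- Every edge of an acyclic graph is a bridge, and by simplicity `e` is the only edge between its
ends, so all of `A` survives its deletion. -/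
lemma IsForest.not_conn {G : Graph α β} (hG : G.IsForest) {A : Set β} {e : β} {x y : α}
    (he : G.IsLink e x y) (heA : e ∉ A) : ¬ G.Conn A x y := by
  have := hG.simple
  have hne : x ≠ y := he.ne
  intro h
  have hadj : G.toSimpleGraph.Adj ⟨x, he.left_mem⟩ ⟨y, he.right_mem⟩ := by
    rw [toSimpleGraph_adj]
    exact ⟨fun h => hne (congrArg Subtype.val h), e, he⟩
  have hb := (SimpleGraph.isAcyclic_iff_forall_isBridge.1 hG.acyclic)
    (e := s(⟨x, he.left_mem⟩, ⟨y, he.right_mem⟩)) hadj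
  rw [SimpleGraph.isBridge_iff] at hb
  have hr : ∀ e' ∈ A, ∀ a b : G.vertexSet, G.IsLink e' a b → (G.toSimpleGraph.deleteEdges
      {s(⟨x, he.left_mem⟩, ⟨y, he.right_mem⟩)}).Reachable a b := by
    intro e' he' a b hl
    refine SimpleGraph.Adj.reachable ?_
    rw [SimpleGraph.deleteEdges_adj, toSimpleGraph_adj]
    refine ⟨⟨fun h => hl.ne (congrArg Subtype.val h), e', hl⟩, fun hs => heA ?_⟩
    have hl' : G.IsLink e' x y := by
      simp only [Set.mem_singleton_iff, Sym2.eq_iff, Subtype.ext_iff] at hs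
      rcases hs with ⟨h1, h2⟩ | ⟨h1, h2⟩
      · rwa [← h1, ← h2]
      · rw [← h1, ← h2]; exact hl.symm
    rwa [Simple.eq_of_isLink he hl']
  rcases Conn.eq_or_reachable hr h with h | ⟨_, _, h⟩
  · exact hne h
  · exact hb h

lemma IsForest.numComponents_add_card {G : Graph α β} (hG : G.IsForest)
    (hfin : G.vertexSet.Finite) (A : Finset β) (hA : ↑A ⊆ G.edgeSet) :
    G.numComponents A + A.card = G.vertexSet.ncard := by
  classical
  induction A using Finset.induction_on with
  | empty => simp [numComponents_empty]
  | insert e A he ih =>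
    rw [Finset.coe_insert, Set.insert_subset_iff] at hA
    obtain ⟨x, y, hl⟩ := exists_isLink_of_mem_edgeSet hA.1
    have := numComponents_insert_bridge (A := (A : Set β)) hfin hl (hG.not_conn hl (by simpa))
    rw [Finset.card_insert_of_notMem he, Finset.coe_insert, ← ih hA.2]
    omega

end Graph

namespace Graph

variable {α β : Type*}

/-! ### Connectedness and components under parallel and series extensions -/

section extensions

variable {G H : Graph α β} {A : Set β} {e f g : β} {x y w a b : α}

/-- The edge `g` is bypassed: its ends are joined by the other edges of `G`. -/
def Bypassed (G : Graph α β) (g : β) : Prop :=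
  ∃ a b, G.IsLink g a b ∧ G.Conn (G.edgeSet \ {g}) a b

lemma isLink_of_sym2_eq (he : G.IsLink e x y) (h : s(a, b) = s(x, y)) : G.IsLink e a b := by
  rcases Sym2.eq_iff.1 h with ⟨rfl, rfl⟩ | ⟨rfl, rfl⟩
  exacts [he, he.symm]

lemma Conn.of_sym2_eq (he : G.Conn A x y) (h : s(a, b) = s(x, y)) : G.Conn A a b := by
  rcases Sym2.eq_iff.1 h with ⟨rfl, rfl⟩ | ⟨rfl, rfl⟩
  exacts [he, he.symm]

/-- `H` arises from `G` by adding an edge `f` parallel to the edge `e`, which joins `x` and `y`. -/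
structure ParallelData (G H : Graph α β) (e f : β) (x y : α) : Prop where
  link : G.IsLink e x y
  new_edge : f ∉ G.edgeSet
  vertexSet_eq : H.vertexSet = G.vertexSet
  isLink_iff : ∀ e' a b, H.IsLink e' a b ↔ G.IsLink e' a b ∨ (e' = f ∧ s(a, b) = s(x, y))

namespace ParallelData

lemma edgeSet_eq (h : ParallelData G H e f x y) : H.edgeSet = insert f G.edgeSet := by
  ext g
  rw [H.edge_mem_iff_exists_isLink, Set.mem_insert_iff, G.edge_mem_iff_exists_isLink]
  simp only [h.isLink_iff]
  constructor
  · rintro ⟨a, b, hl | ⟨rfl, _⟩⟩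
    exacts [Or.inr ⟨a, b, hl⟩, Or.inl rfl]
  · rintro (rfl | ⟨a, b, hl⟩)
    exacts [⟨x, y, Or.inr ⟨rfl, rfl⟩⟩, ⟨a, b, Or.inl hl⟩]

lemma ne (h : ParallelData G H e f x y) : e ≠ f := fun h' => h.new_edge (h' ▸ h.link.edge_mem)

lemma link_left (h : ParallelData G H e f x y) : H.IsLink e x y :=
  (h.isLink_iff _ _ _).2 (Or.inl h.link)

lemma link_right (h : ParallelData G H e f x y) : H.IsLink f x y :=
  (h.isLink_iff _ _ _).2 (Or.inr ⟨rfl, rfl⟩)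

lemma conn_iff_of_notMem (h : ParallelData G H e f x y) (hf : f ∉ A) :
    H.Conn A a b ↔ G.Conn A a b := by
  constructor
  · refine Conn.of_forall fun e' he' a b hl => ?_
    rcases (h.isLink_iff _ _ _).1 hl with hl | ⟨rfl, _⟩
    exacts [Conn.of_isLink he' hl, absurd he' hf]
  · exact Conn.of_forall fun e' he' a b hl =>
      Conn.of_isLink he' ((h.isLink_iff _ _ _).2 (Or.inl hl))

lemma conn_insert_iff (h : ParallelData G H e f x y) : H.Conn (insert f A) a b ↔ G.Conn
    (insert e A) a b := by
  constructor
  · refine Conn.of_forall fun e' he' a b hl => ?_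
    rcases (h.isLink_iff _ _ _).1 hl with hl | ⟨rfl, hs⟩
    · refine Conn.of_isLink (Or.inr (he'.resolve_left fun h' => ?_)) hl
      exact h.new_edge (h' ▸ hl.edge_mem)
    · exact Conn.of_isLink (Or.inl rfl) (isLink_of_sym2_eq h.link hs)
  · rintro hab
    refine Conn.of_forall (fun e' he' a b hl => ?_) hab
    rcases he' with rfl | he'
    · refine Conn.of_isLink (Or.inl rfl) ((h.isLink_iff _ _ _).2 (Or.inr ⟨rfl, ?_⟩))
      rcases hl.eq_and_eq_or_eq_and_eq h.link with ⟨rfl, rfl⟩ | ⟨rfl, rfl⟩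
      exacts [rfl, Sym2.eq_swap]
    · exact Conn.of_isLink (Or.inr he') ((h.isLink_iff _ _ _).2 (Or.inl hl))

lemma bypassed_left (h : ParallelData G H e f x y) : H.Bypassed e :=
  ⟨x, y, h.link_left, Conn.of_isLink ⟨h.link_right.edge_mem, h.ne.symm⟩ h.link_right⟩

lemma bypassed_right (h : ParallelData G H e f x y) : H.Bypassed f :=
  ⟨x, y, h.link_right, Conn.of_isLink ⟨h.link_left.edge_mem, h.ne⟩ h.link_left⟩

lemma bypassed_of_ne (h : ParallelData G H e f x y) (hg : G.Bypassed g) : H.Bypassed g := by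
  obtain ⟨a, b, hl, hc⟩ := hg
  refine ⟨a, b, (h.isLink_iff _ _ _).2 (Or.inl hl), Conn.of_forall (fun e' he' a b hl => ?_) hc⟩
  have := (h.isLink_iff _ _ _).2 (Or.inl hl)
  exact Conn.of_isLink ⟨this.edge_mem, he'.2⟩ this

end ParallelData

/-- `H` arises from `G` by subdividing the edge `e`, which joins `x` and `y`, into an edge `e`
from `x` to a new vertex `w` and an edge `f` from `w` to `y`. -/
structure SeriesData (G H : Graph α β) (e f : β) (x y w : α) : Prop where
  link : G.IsLink e x y
  new_edge : f ∉ G.edgeSet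
  new_vertex : w ∉ G.vertexSet
  vertexSet_eq : H.vertexSet = insert w G.vertexSet
  isLink_iff : ∀ e' a b, H.IsLink e' a b ↔
      (G.IsLink e' a b ∧ e' ≠ e) ∨ (e' = e ∧ s(a, b) = s(x, w)) ∨ (e' = f ∧ s(a, b) = s(w, y))

namespace SeriesData

lemma link_left (h : SeriesData G H e f x y w) : H.IsLink e x w :=
  (h.isLink_iff _ _ _).2 (Or.inr (Or.inl ⟨rfl, rfl⟩))

lemma link_right (h : SeriesData G H e f x y w) : H.IsLink f w y :=
  (h.isLink_iff _ _ _).2 (Or.inr (Or.inr ⟨rfl, rfl⟩))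

lemma link_of_ne (h : SeriesData G H e f x y w) (hl : G.IsLink g a b) (hg : g ≠ e) :
    H.IsLink g a b :=
  (h.isLink_iff _ _ _).2 (Or.inl ⟨hl, hg⟩)

lemma edgeSet_eq (h : SeriesData G H e f x y w) : H.edgeSet = insert f G.edgeSet := by
  ext g
  rw [Set.mem_insert_iff]
  constructor
  · intro hg
    obtain ⟨a, b, hl⟩ := exists_isLink_of_mem_edgeSet hg
    rcases (h.isLink_iff _ _ _).1 hl with ⟨hl, _⟩ | ⟨rfl, _⟩ | ⟨rfl, _⟩
    exacts [Or.inr hl.edge_mem, Or.inr h.link.edge_mem, Or.inl rfl]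
  · rintro (rfl | hg)
    · exact h.link_right.edge_mem
    · by_cases hge : g = e
      · exact hge ▸ h.link_left.edge_mem
      · obtain ⟨a, b, hl⟩ := exists_isLink_of_mem_edgeSet hg
        exact (h.link_of_ne hl hge).edge_mem

lemma ne (h : SeriesData G H e f x y w) : e ≠ f := fun h' => h.new_edge (h' ▸ h.link.edge_mem)

lemma conn_of_conn (h : SeriesData G H e f x y w) {B : Set β} (hAB : A \ {e} ⊆ B)
    (he : e ∈ A → e ∈ B ∧ f ∈ B)
    (hc : G.Conn A a b) : H.Conn B a b := by
  refine Conn.of_forall (fun e' he' a b hl => ?_) hc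
  by_cases hee : e' = e
  · subst hee
    have hxy : H.Conn B x y :=
      (Conn.of_isLink (he he').1 h.link_left).trans (Conn.of_isLink (he he').2 h.link_right)
    rcases hl.eq_and_eq_or_eq_and_eq h.link with ⟨rfl, rfl⟩ | ⟨rfl, rfl⟩
    exacts [hxy, hxy.symm]
  · exact Conn.of_isLink (hAB ⟨he', hee⟩) (h.link_of_ne hl hee)

/-- Edges of `H` can be contracted to `G` by mapping the new vertex `w` to `z`. -/
lemma conn_of_conn_extension (h : SeriesData G H e f x y w) {B : Set β} {z : α} (ha : a ≠ w)
    (hb : b ≠ w)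
    (hBA : ∀ g ∈ B, g ≠ e → g ≠ f → g ∈ A)
    (he : e ∈ B → G.Conn A x z) (hf : f ∈ B → G.Conn A z y) (hc : H.Conn B a b) :
    G.Conn A a b := by
  classical
  let p : α → α := fun u => if u = w then z else u
  have hp {u : α} (hu : u ∈ G.vertexSet) : p u = u :=
    if_neg fun (h' : u = w) => h.new_vertex (h' ▸ hu)
  have hpw : p w = z := if_pos rfl
  have := Conn.map (H := G) (B := A) p (fun e' he' a b hl => ?_) hc
  · rwa [show p a = a from if_neg ha, show p b = b from if_neg hb] at this
  · rcases (h.isLink_iff _ _ _).1 hl with ⟨hl, hne⟩ | ⟨rfl, hs⟩ | ⟨rfl, hs⟩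
    · rw [hp hl.left_mem, hp hl.right_mem]
      exact Conn.of_isLink (hBA _ he' hne fun h' => h.new_edge (h' ▸ hl.edge_mem)) hl
    · have : G.Conn A (p x) (p w) := by rw [hp h.link.left_mem, hpw]; exact he he'
      rcases Sym2.eq_iff.1 hs with ⟨rfl, rfl⟩ | ⟨rfl, rfl⟩
      exacts [this, this.symm]
    · have : G.Conn A (p w) (p y) := by rw [hp h.link.right_mem, hpw]; exact hf he'
      rcases Sym2.eq_iff.1 hs with ⟨rfl, rfl⟩ | ⟨rfl, rfl⟩
      exacts [this, this.symm]

lemma ne_of_mem (h : SeriesData G H e f x y w) (ha : a ∈ G.vertexSet) : a ≠ w :=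
  fun h' => h.new_vertex (h' ▸ ha)

lemma not_conn_new (h : SeriesData G H e f x y w) (heA : e ∉ A) (hfA : f ∉ A)
    (ha : a ∈ G.vertexSet) : ¬ H.Conn A a w := by
  intro hc
  have : (a = w) = (w = w) := by
    refine Conn.lift (s := Eq) ⟨fun _ => rfl, Eq.symm, Eq.trans⟩ (fun u => u = w) ?_ hc
    intro e' he' a b hl
    rcases (h.isLink_iff _ _ _).1 hl with ⟨hl, hne⟩ | ⟨rfl, hs⟩ | ⟨rfl, hs⟩
    · exact propext (iff_of_false (h.ne_of_mem hl.left_mem) (h.ne_of_mem hl.right_mem))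
    · exact absurd he' heA
    · exact absurd he' hfA
  exact h.ne_of_mem ha (this.symm.mp rfl)

/-- With neither half of the subdivided edge, `w` is an extra component; with one half it is a leaf;
with both, the edge is restored. These cases account for the series weights `q * (a e * a f) + a e *
b f + b e * a f` and `b e * b f`. -/
lemma numComponents_of_notMem (h : SeriesData G H e f x y w) (hfin : G.vertexSet.Finite)
    (heA : e ∉ A) (hfA : f ∉ A) :
    H.numComponents A = G.numComponents A + 1 :=
  numComponents_insert_isolated hfin h.vertexSet_eq
    (fun _ ha _ hb => ⟨h.conn_of_conn_extension (z := x) (h.ne_of_mem ha) (h.ne_of_mem hb)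
      (fun _ hg _ _ => hg) (fun h' => absurd h' heA) (fun h' => absurd h' hfA),
      h.conn_of_conn Set.sdiff_subset (fun h' => absurd h' heA)⟩)
    (fun _ ha => h.not_conn_new heA hfA ha)

lemma numComponents_insert_left (h : SeriesData G H e f x y w) (heA : e ∉ A) (hfA : f ∉ A) :
    H.numComponents (insert e A) = G.numComponents A :=
  numComponents_insert_of_conn h.vertexSet_eq
    (fun _ ha _ hb => ⟨h.conn_of_conn_extension (z := x) (h.ne_of_mem ha) (h.ne_of_mem hb)
      (fun _ hg hne _ => hg.resolve_left hne) (fun _ => Conn.refl _)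
      (fun h' => absurd (h'.resolve_left h.ne.symm) hfA),
      h.conn_of_conn (Set.sdiff_subset.trans (Set.subset_insert _ _)) (fun h' => absurd h' heA)⟩)
    h.link.left_mem (Conn.of_isLink (Or.inl rfl) h.link_left)

lemma numComponents_insert_right (h : SeriesData G H e f x y w) (heA : e ∉ A) :
    H.numComponents (insert f A) = G.numComponents A :=
  numComponents_insert_of_conn h.vertexSet_eq
    (fun _ ha _ hb => ⟨h.conn_of_conn_extension (z := y) (h.ne_of_mem ha) (h.ne_of_mem hb)
      (fun _ hg _ hne => hg.resolve_left hne)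
      (fun h' => absurd (h'.resolve_left h.ne) heA) (fun _ => Conn.refl _),
      h.conn_of_conn (Set.sdiff_subset.trans (Set.subset_insert _ _)) (fun h' => absurd h' heA)⟩)
    h.link.right_mem (Conn.of_isLink (Or.inl rfl) h.link_right.symm)

lemma numComponents_insert_insert (h : SeriesData G H e f x y w) :
    H.numComponents (insert f (insert e A)) = G.numComponents (insert e A) :=
  numComponents_insert_of_conn h.vertexSet_eq
    (fun _ ha _ hb => ⟨h.conn_of_conn_extension (z := x) (h.ne_of_mem ha) (h.ne_of_mem hb)
      (fun _ hg _ hne => hg.resolve_left hne)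
      (fun _ => Conn.refl _) (fun _ => Conn.of_isLink (Or.inl rfl) h.link),
      h.conn_of_conn (Set.sdiff_subset.trans (Set.subset_insert _ _))
        (fun _ => ⟨Or.inr (Or.inl rfl), Or.inl rfl⟩)⟩)
    h.link.left_mem (Conn.of_isLink (Or.inr (Or.inl rfl)) h.link_left)

lemma conn_bypass (h : SeriesData G H e f x y w) (hc : G.Conn (G.edgeSet \ {e}) x y) :
    H.Conn (H.edgeSet \ {e, f}) x y := by
  refine h.conn_of_conn ?_ (fun h' => absurd rfl h'.2) hc
  rintro g ⟨⟨hg, hne⟩, _⟩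
  refine ⟨h.edgeSet_eq ▸ Or.inr hg, ?_⟩
  rintro (rfl | rfl)
  exacts [hne rfl, h.new_edge hg]

lemma conn_bypass_of_bypassed (h : SeriesData G H e f x y w) (hg : G.Bypassed e) : G.Conn
    (G.edgeSet \ {e}) x y := by
  obtain ⟨a, b, hl, hc⟩ := hg
  rcases hl.eq_and_eq_or_eq_and_eq h.link with ⟨rfl, rfl⟩ | ⟨rfl, rfl⟩
  exacts [hc, hc.symm]

lemma bypassed_left (h : SeriesData G H e f x y w) (hg : G.Bypassed e) : H.Bypassed e := by
  refine ⟨x, w, h.link_left, ?_⟩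
  refine ((h.conn_bypass (h.conn_bypass_of_bypassed hg)).mono ?_).trans
    (Conn.of_isLink ⟨h.link_right.edge_mem, h.ne.symm⟩ h.link_right.symm)
  exact fun g hg => ⟨hg.1, fun h' => hg.2 (Or.inl h')⟩

lemma bypassed_right (h : SeriesData G H e f x y w) (hg : G.Bypassed e) : H.Bypassed f := by
  refine ⟨w, y, h.link_right, ?_⟩
  refine (Conn.of_isLink (A := H.edgeSet \ {f}) ⟨h.link_left.edge_mem, h.ne⟩
    h.link_left.symm).trans
    ((h.conn_bypass (h.conn_bypass_of_bypassed hg)).mono ?_)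
  exact fun g hg => ⟨hg.1, fun h' => hg.2 (Or.inr h')⟩

lemma bypassed_of_ne (h : SeriesData G H e f x y w) (hg : G.Bypassed g) (hge : g ≠ e) :
    H.Bypassed g := by
  obtain ⟨a, b, hl, hc⟩ := hg
  refine ⟨a, b, h.link_of_ne hl hge, h.conn_of_conn ?_ (fun _ => ?_) hc⟩
  · rintro e' ⟨⟨he', hne⟩, _⟩
    exact ⟨h.edgeSet_eq ▸ Or.inr he', hne⟩
  · exact ⟨⟨h.link_left.edge_mem, hge.symm⟩, h.link_right.edge_mem,
      fun h' => h.new_edge (h' ▸ hl.edge_mem)⟩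

end SeriesData

end extensions

lemma IsSeriesParallel.loopless {G : Graph α β} (hG : G.IsSeriesParallel) : G.Loopless := by
  induction hG with
  | forest G hG => exact hG.simple.toLoopless
  | parallel G H _ h ih =>
    obtain ⟨e, f, x, y, hl, _, _, hL⟩ := h
    refine ⟨fun g z hz => ?_⟩
    rcases (hL _ _ _).1 hz with hz | ⟨_, hs⟩
    · exact ih.not_isLoopAt g z hz
    · exact ih.not_isLoopAt e z (isLink_of_sym2_eq hl hs)
  | series G H _ h ih =>
    obtain ⟨e, f, x, y, w, hl, _, hw, _, hL⟩ := h
    refine ⟨fun g z hz => ?_⟩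
    rcases (hL _ _ _).1 hz with ⟨hz, _⟩ | ⟨_, hs⟩ | ⟨_, hs⟩
    · exact ih.not_isLoopAt g z hz
    · rcases Sym2.eq_iff.1 hs with ⟨rfl, rfl⟩ | ⟨rfl, rfl⟩ <;> exact hw hl.left_mem
    · rcases Sym2.eq_iff.1 hs with ⟨rfl, rfl⟩ | ⟨rfl, rfl⟩ <;> exact hw hl.right_mem

/-! ### Flows with edge capacities -/

section flow

variable {G H : Graph α β} {k : β → ℕ} {Λ : ℕ} {e f : β} {x y w : α}

open Classical in
/-- With edge capacities `k`, no flow between distinct vertices of `G` exceeds `Λ`. -/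
def FlowLE (G : Graph α β) (k : β → ℕ) (Λ : ℕ) : Prop :=
  ∀ (n : ℕ) (P : Fin n → Set β) (x y : α), x ≠ y → (∀ i, G.Conn (P i) x y) →
    (∀ e ∈ G.edgeSet, (Finset.univ.filter fun i => e ∈ P i).card ≤ k e) → n ≤ Λ

/-- Send `k e` units through `e` alone and one more, index `0`, through all the other edges: a flow
of `k e + 1`. -/
lemma FlowLE.capacity_lt (h : G.FlowLE k Λ) (hk : ∀ g ∈ G.edgeSet, 1 ≤ k g) [G.Loopless]
    (he : G.Bypassed e) : k e < Λ := by
  classical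
  obtain ⟨x, y, hl, hc⟩ := he
  refine h (k e + 1) (fun i => {g | g ∈ G.edgeSet ∧ (g = e ↔ i ≠ 0)}) x y hl.ne (fun i => ?_)
    fun g hg => ?_
  · by_cases hi : i = 0
    · exact hc.mono fun g hg => ⟨hg.1, by simpa [hi] using hg.2⟩
    · exact Conn.of_isLink ⟨hl.edge_mem, by simp [hi]⟩ hl
  · by_cases hge : g = e
    · simp only [hge, Set.mem_ofPred_eq, hl.edge_mem, true_and, true_iff]
      rw [Finset.filter_ne', Finset.card_erase_of_mem (Finset.mem_univ _)]
      simp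
    · have := hk g hg
      simpa [hge, hg, Finset.filter_eq'] using this

-- A flow in `G` is lifted to `H` by moving as many users of `e` as `f` can carry, the set `T`, over
-- to `f`.
open Classical in
lemma FlowLE.of_parallel (h : ParallelData G H e f x y) (hk : H.FlowLE k Λ) :
    G.FlowLE (Function.update k e (k e + k f)) Λ := by
  intro n P a b hab hP hload
  obtain ⟨T, hT, hTc⟩ : ∃ T ⊆ Finset.univ.filter (fun i => e ∈ P i),
      T.card = min (k f) (Finset.univ.filter (fun i => e ∈ P i)).card :=
    Finset.exists_subset_card_eq (min_le_right _ _)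
  have hload_e := hload e h.link.edge_mem
  rw [Function.update_self] at hload_e
  refine hk n (fun i => {g | (g ≠ e ∧ g ≠ f ∧ g ∈ P i) ∨ (g = e ∧ e ∈ P i ∧ i ∉ T) ∨
    (g = f ∧ i ∈ T)}) a b hab (fun i => ?_) fun g hg => ?_
  · refine Conn.of_forall (fun e' he' a b hl => ?_) (hP i)
    by_cases hee : e' = e
    · subst hee
      by_cases hi : i ∈ T
      · refine Conn.of_sym2_eq (Conn.of_isLink (Or.inr (Or.inr ⟨rfl, hi⟩)) h.link_right) ?_
        rcases hl.eq_and_eq_or_eq_and_eq h.link with ⟨rfl, rfl⟩ | ⟨rfl, rfl⟩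
        exacts [rfl, Sym2.eq_swap]
      · exact Conn.of_isLink (Or.inr (Or.inl ⟨rfl, he', hi⟩)) ((h.isLink_iff _ _ _).2 (Or.inl hl))
    · exact Conn.of_isLink (Or.inl ⟨hee, fun h' => h.new_edge (h' ▸ hl.edge_mem), he'⟩)
        ((h.isLink_iff _ _ _).2 (Or.inl hl))
  · by_cases hge : g = e
    · subst hge
      refine (congrArg Finset.card (a₂ := (Finset.univ.filter fun i => g ∈ P i) \ T)
        (by ext i; simp [h.ne])).trans_le ?_
      rw [Finset.card_sdiff_of_subset hT, hTc]
      omega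
    · by_cases hgf : g = f
      · subst hgf
        refine (congrArg Finset.card (a₂ := T) (by ext i; simp [hge])).trans_le ?_
        rw [hTc]
        exact min_le_left _ _
      · have := hload g ((h.edgeSet_eq ▸ hg : g ∈ insert f G.edgeSet).resolve_left hgf)
        rw [Function.update_of_ne hge] at this
        simpa [hge, hgf] using this

-- Capacity 1, rather than the minimum of the two, is enough to record, because a series composition
-- lands in the smallest disc anyway.
open Classical in
lemma FlowLE.of_series (h : SeriesData G H e f x y w) (hk : H.FlowLE k Λ)
    (hke : 1 ≤ k e) (hkf : 1 ≤ k f) : G.FlowLE (Function.update k e 1) Λ := by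
  intro n P a b hab hP hload
  have hload_e := hload e h.link.edge_mem
  rw [Function.update_self] at hload_e
  refine hk n (fun i => {g | (g ≠ f ∧ g ∈ P i) ∨ (g = f ∧ e ∈ P i)}) a b hab (fun i => ?_)
    fun g hg => ?_
  · refine Conn.of_forall (fun e' he' a b hl => ?_) (hP i)
    refine h.conn_of_conn (A := {e'}) ?_ ?_ (Conn.of_isLink rfl hl)
    · rintro _ ⟨rfl, hne⟩
      exact Or.inl ⟨fun h' => h.new_edge (h' ▸ hl.edge_mem), he'⟩
    · rintro rfl
      exact ⟨Or.inl ⟨h.ne, he'⟩, Or.inr ⟨rfl, he'⟩⟩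
  · by_cases hgf : g = f
    · subst hgf
      have : (Finset.univ.filter fun i => e ∈ P i).card ≤ k g := hload_e.trans hkf
      simpa using this
    · have := hload g ((h.edgeSet_eq ▸ hg : g ∈ insert f G.edgeSet).resolve_left hgf)
      by_cases hge : g = e
      · subst hge
        simpa [hgf] using hload_e.trans hke
      · rw [Function.update_of_ne hge] at this
        simpa [hgf] using this

lemma IsPath.exists_suffix {z u : α} {S : Set α} {P : Set β} (h : G.IsPath y z S P) (hu : u ∈ S) :
    ∃ S' P', P' ⊆ P ∧ G.IsPath u z S' P' := by
  induction h with
  | nil x hx => exact ⟨{x}, ∅, subset_rfl, by rw [show u = x from hu]; exact .nil x hx⟩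
  | cons e x y z S P he hP hx ih =>
    rcases hu with rfl | hu
    · exact ⟨_, _, subset_rfl, .cons e u y z S P he hP hx⟩
    · obtain ⟨S', P', hP', h⟩ := ih hu
      exact ⟨S', P', hP'.trans (Set.subset_insert _ _), h⟩

lemma Conn.exists_isPath {A : Set β} (h : G.Conn A x y) (hxy : x ≠ y) :
    ∃ S P, P ⊆ A ∧ G.IsPath x y S P := by
  have hy := h.symm.left_mem_of_ne hxy.symm
  have : Std.Symm fun a b => ∃ e ∈ A, G.IsLink e a b := ⟨fun a b ⟨e, he, hl⟩ => ⟨e, he, hl.symm⟩⟩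
  rw [Conn, Relation.EqvGen.eqvGen_eq_reflTransGen] at h
  clear hxy
  induction h using Relation.ReflTransGen.head_induction_on with
  | refl => exact ⟨_, _, Set.empty_subset _, .nil y hy⟩
  | @head a c hac _ ih =>
    obtain ⟨e, he, hl⟩ := hac
    obtain ⟨S, P, hP, hpath⟩ := ih
    by_cases ha : a ∈ S
    · obtain ⟨S', P', hP', h'⟩ := hpath.exists_suffix ha
      exact ⟨S', P', hP'.trans hP, h'⟩
    · exact ⟨_, _, Set.insert_subset he hP, .cons e a c y S P hl hpath ha⟩

lemma flowLE_of_maxmaxflow_le (h : G.maxmaxflow ≤ Λ) : G.FlowLE (fun _ => 1) Λ := by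
  classical
  intro n P x y hxy hP hload
  have hx := fun i => (hP i).left_mem_of_ne hxy
  have hy := fun i => (hP i).symm.left_mem_of_ne hxy.symm
  rcases Nat.eq_zero_or_pos n with rfl | hn
  · exact Nat.zero_le _
  choose S P' hP' hpath using fun i => (hP i).exists_isPath hxy
  have hsub : ∀ {y' x' S Q}, G.IsPath x' y' S Q → Q ⊆ G.edgeSet := by
    intro y' x' S Q hQ
    induction hQ with
    | nil => exact Set.empty_subset _
    | cons e x y z S P he hP hx ih => exact Set.insert_subset he.edge_mem ih
  have hdis : G.HasEdgeDisjointPaths x y n := by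
    refine ⟨P', fun i => ⟨S i, hpath i⟩, fun i j hij => Set.disjoint_left.2 fun e hi hj => hij ?_⟩
    exact Finset.card_le_one.1 (hload e (hsub (hpath i) hi)) i (by simpa using hP' i hi) j
      (by simpa using hP' j hj)
  have h1 : (n : ℕ∞) ≤ G.maxFlow x y :=
    le_iSup₂ (f := fun (k : ℕ) (_ : G.HasEdgeDisjointPaths x y k) => (k : ℕ∞)) n hdis
  have h2 : G.maxFlow x y ≤ G.maxmaxflow :=
    le_trans (le_iSup (fun _ : x ≠ y => G.maxFlow x y) hxy)
      (le_trans (le_iSup₂ (f := fun y (_ : y ∈ G.vertexSet) => ⨆ (_ : x ≠ y), G.maxFlow x y) y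
        (hy ⟨0, hn⟩)) (le_iSup₂ (f := fun x (_ : x ∈ G.vertexSet) =>
          ⨆ (y ∈ G.vertexSet) (_ : x ≠ y), G.maxFlow x y) x (hx ⟨0, hn⟩)))
  exact_mod_cast h1.trans (h2.trans h)

end flow

end Graph

/-! ### Transmissivities under parallel composition and real scaling -/

section transmissivity

/-! With `y = 1 + v` and `Q = q - 1`, the transmissivity `v / (q + v)` is `(y - 1) / (y + Q)`. -/

variable {Q y z : ℂ} {r s ρ : ℝ}

/-- If `y` and `z` have transmissivities `t₁` and `t₂`, then `y * z` has `(t₁ + t₂ + (Q - 1) t₁ t₂)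
/ (1 + Q t₁ t₂)`. The triangle inequality is applied to numerator and denominator, with quotients
cleared. -/
lemma transmissivity_mul_le {t : ℝ} (hQ : 1 + Q ≠ 0) (hr : 0 ≤ r) (ht : 0 ≤ t)
    (hy : ‖y - 1‖ ≤ r * ‖y + Q‖) (hz : ‖z - 1‖ ≤ s * ‖z + Q‖)
    (h : r + s + (‖Q‖ + 1) * (r * s) ≤ t * (1 - ‖Q‖ * (r * s))) :
    ‖y * z - 1‖ ≤ t * ‖y * z + Q‖ := by
  have hQ' : 0 < ‖1 + Q‖ := norm_pos_iff.2 hQ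
  set B := ‖y + Q‖
  set C := ‖z + Q‖
  have hB : 0 ≤ B := norm_nonneg _
  have hC : 0 ≤ C := norm_nonneg _
  have hQn : 0 ≤ ‖Q‖ := norm_nonneg _
  have hAA : ‖y - 1‖ * ‖z - 1‖ ≤ (r * s) * (B * C) := by
    calc ‖y - 1‖ * ‖z - 1‖ ≤ (r * B) * (s * C) :=
          mul_le_mul hy hz (norm_nonneg _) (by positivity)
      _ = _ := by ring
  have hAB : ‖y - 1‖ * C ≤ r * (B * C) := by
    calc ‖y - 1‖ * C ≤ (r * B) * C := by gcongr
      _ = _ := by ring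
  have hBA : B * ‖z - 1‖ ≤ s * (B * C) := by
    calc B * ‖z - 1‖ ≤ B * (s * C) := by gcongr
      _ = _ := by ring
  have h1 : ‖1 + Q‖ * ‖y * z - 1‖ ≤ (r + s + (‖Q‖ + 1) * (r * s)) * (B * C) := by
    rw [← norm_mul, show (1 + Q) * (y * z - 1) =
      (y - 1) * (z + Q) + (y + Q) * (z - 1) + (Q - 1) * ((y - 1) * (z - 1)) by ring]
    have h3 : ‖(Q - 1) * ((y - 1) * (z - 1))‖ ≤ (‖Q‖ + 1) * (‖y - 1‖ * ‖z - 1‖) := by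
      rw [norm_mul, norm_mul]
      gcongr
      simpa using norm_sub_le Q 1
    refine (norm_add₃_le ..).trans ?_
    rw [norm_mul, norm_mul]
    have := mul_le_mul_of_nonneg_left hAA (by positivity : (0 : ℝ) ≤ ‖Q‖ + 1)
    linarith
  have h2 : (1 - ‖Q‖ * (r * s)) * (B * C) ≤ ‖1 + Q‖ * ‖y * z + Q‖ := by
    rw [← norm_mul (1 + Q), show (1 + Q) * (y * z + Q) =
      (y + Q) * (z + Q) + Q * ((y - 1) * (z - 1)) by ring]
    have h3 := norm_sub_le_norm_add ((y + Q) * (z + Q)) (Q * ((y - 1) * (z - 1)))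
    rw [norm_mul, norm_mul, norm_mul] at h3
    have := mul_le_mul_of_nonneg_left hAA hQn
    linarith
  refine le_of_mul_le_mul_left ?_ hQ'
  calc _ ≤ _ := h1
    _ ≤ (t * (1 - ‖Q‖ * (r * s))) * (B * C) := by gcongr
    _ ≤ t * (‖1 + Q‖ * ‖y * z + Q‖) := by rw [mul_assoc]; gcongr
    _ = _ := by ring

/-- Vanishing would mean `1 + Q t₁ t₂ = 0`, whereas `|Q t₁ t₂| ≤ ρ ^ 2 / ρ < 1`. No bound on the sum
of capacities is involved, so this also serves parallel edges that merge into a bridge. -/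
lemma mul_add_ne_zero_of_transmissivity (hQ : 1 + Q ≠ 0) (hρ : 0 < ρ) (hρ1 : ρ < 1)
    (hρQ : ρ * ‖Q‖ = 1) (hy : ‖y - 1‖ ≤ ρ * ‖y + Q‖) (hz : ‖z - 1‖ ≤ ρ * ‖z + Q‖) :
    y * z + Q ≠ 0 := by
  have key {u : ℂ} (hu : ‖u - 1‖ ≤ ρ * ‖u + Q‖) : 0 < ‖u + Q‖ := by
    refine norm_pos_iff.2 fun h0 => hQ ?_
    rw [h0, norm_zero, mul_zero] at hu
    rw [← sub_eq_zero.1 (norm_le_zero_iff.1 hu), h0]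
  have hB := key hy
  have hC := key hz
  intro h0
  have h1 : (y + Q) * (z + Q) = -(Q * ((y - 1) * (z - 1))) := by
    linear_combination (1 + Q) * h0
  have h2 := congrArg norm h1
  rw [norm_neg, norm_mul, norm_mul, norm_mul] at h2
  have h3 : ‖y - 1‖ * ‖z - 1‖ ≤ (ρ * ‖y + Q‖) * (ρ * ‖z + Q‖) :=
    mul_le_mul hy hz (norm_nonneg _) (by positivity)
  have h4 := mul_le_mul_of_nonneg_left h3 (norm_nonneg Q)
  have h5 : ‖Q‖ * (ρ * ‖y + Q‖ * (ρ * ‖z + Q‖)) = ρ * (‖y + Q‖ * ‖z + Q‖) := by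
    linear_combination ρ * ‖y + Q‖ * ‖z + Q‖ * hρQ
  have := mul_pos hB hC
  nlinarith

/-- The disc of values of `y` with transmissivity at most `ρ = 1 / ‖Q‖` has `0` on its boundary. -/
lemma transmissivity_real_mul_le (hρ : 0 ≤ ρ) (hρ1 : ρ ≤ 1) (hρQ : ρ * ‖Q‖ = 1) (hs : 0 ≤ s)
    (hs1 : s ≤ 1) (hy : ‖y - 1‖ ≤ ρ * ‖y + Q‖) : ‖s * y - 1‖ ≤ ρ * ‖s * y + Q‖ := by
  have hQ2 : ρ ^ 2 * (Q.re * Q.re + Q.im * Q.im) = 1 := by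
    rw [← Complex.normSq_apply, ← Complex.sq_norm, ← mul_pow, hρQ, one_pow]
  -- The constant term cancels because `ρ * ‖Q‖ = 1`. What is left compares a quadratic form with a
  -- linear one, and `s ^ 2 ≤ s`.
  have expand (u : ℂ) : ‖u - 1‖ ≤ ρ * ‖u + Q‖ ↔
      (u.re ^ 2 + u.im ^ 2) * (1 - ρ ^ 2) ≤
        2 * u.re + 2 * ρ ^ 2 * (u.re * Q.re + u.im * Q.im) := by
    rw [← sq_le_sq₀ (norm_nonneg _) (by positivity), mul_pow, Complex.sq_norm, Complex.sq_norm,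
      Complex.normSq_apply, Complex.normSq_apply]
    simp only [Complex.sub_re, Complex.add_re, Complex.sub_im, Complex.add_im, Complex.one_re,
      Complex.one_im]
    constructor <;> intro h <;> linarith
  rw [expand] at hy ⊢
  simp only [Complex.mul_re, Complex.mul_im, Complex.ofReal_re, Complex.ofReal_im, zero_mul,
    sub_zero, add_zero]
  have h1 := mul_le_mul_of_nonneg_left hy hs
  have h2 : 0 ≤ (y.re ^ 2 + y.im ^ 2) * (1 - ρ ^ 2) :=
    mul_nonneg (by positivity) (sub_nonneg.2 (pow_le_one₀ hρ hρ1))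
  have h3 : s ^ 2 * ((y.re ^ 2 + y.im ^ 2) * (1 - ρ ^ 2)) ≤
      s * ((y.re ^ 2 + y.im ^ 2) * (1 - ρ ^ 2)) :=
    mul_le_mul_of_nonneg_right (by nlinarith) h2
  linarith

end transmissivity

/-! ### The radii attached to flows; here `m` stands for `Λ - 1` -/

section radii

variable {ρ X : ℝ} {k l m : ℕ}

/-- The radius of the transmissivity disc for a two-terminal network of flow `k`. -/
noncomputable def flowRadius (ρ X : ℝ) (k : ℕ) : ℝ := ρ * ((X ^ k - 1) / (1 - ρ * X ^ k))

lemma pow_le_of_pow_eq (hX : 1 ≤ X) (hXm : X ^ m = 2 / (1 + ρ)) (hk : k ≤ m) :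
    X ^ k ≤ 2 / (1 + ρ) :=
  hXm ▸ pow_le_pow_right₀ hX hk

lemma flowRadius_denom_pos (hρ : 0 < ρ) (hρ1 : ρ < 1) (hX : 1 ≤ X) (hXm : X ^ m = 2 / (1 + ρ))
    (hk : k ≤ m) : 0 < 1 - ρ * X ^ k := by
  have h := pow_le_of_pow_eq hX hXm hk
  rw [le_div_iff₀ (by linarith)] at h
  nlinarith [one_le_pow₀ hX (n := k)]

lemma flowRadius_nonneg (hρ : 0 < ρ) (hρ1 : ρ < 1) (hX : 1 ≤ X) (hXm : X ^ m = 2 / (1 + ρ))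
    (hk : k ≤ m) : 0 ≤ flowRadius ρ X k :=
  mul_nonneg hρ.le (div_nonneg (sub_nonneg.2 (one_le_pow₀ hX))
    (flowRadius_denom_pos hρ hρ1 hX hXm hk).le)

/-- The choice of `X` makes the radius exactly `ρ` at `k = m`. -/
lemma flowRadius_le (hρ : 0 < ρ) (hρ1 : ρ < 1) (hX : 1 ≤ X) (hXm : X ^ m = 2 / (1 + ρ))
    (hk : k ≤ m) : flowRadius ρ X k ≤ ρ := by
  have h := pow_le_of_pow_eq hX hXm hk
  rw [le_div_iff₀ (by linarith)] at h
  refine mul_le_of_le_one_right hρ.le ?_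
  rw [div_le_one (flowRadius_denom_pos hρ hρ1 hX hXm hk)]
  linarith

/-- `-flowRadius ρ X k` is the transmissivity of `y = X ^ k` for `Q = -1 / ρ`, so this is the exact
parallel law for `X ^ k * X ^ l`: the worst case of the triangle inequality. -/
lemma flowRadius_add (hρ : 0 < ρ) (hρ1 : ρ < 1) (hX : 1 ≤ X) (hXm : X ^ m = 2 / (1 + ρ))
    (hk : k + l ≤ m) :
    flowRadius ρ X k + flowRadius ρ X l + (1 / ρ + 1) * (flowRadius ρ X k * flowRadius ρ X l) =
      flowRadius ρ X (k + l) * (1 - 1 / ρ * (flowRadius ρ X k * flowRadius ρ X l)) := by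
  have h1 := (flowRadius_denom_pos hρ hρ1 hX hXm ((Nat.le_add_right k l).trans hk)).ne'
  have h2 := (flowRadius_denom_pos hρ hρ1 hX hXm ((Nat.le_add_left l k).trans hk)).ne'
  have h3 := (flowRadius_denom_pos hρ hρ1 hX hXm hk).ne'
  simp only [flowRadius]
  rw [pow_add] at h3 ⊢
  generalize X ^ k = A at *
  generalize X ^ l = B at *
  have h4 : 1 - ρ * A * B ≠ 0 := by rwa [mul_assoc]
  field_simp
  ring

/-- Cleared of denominators, the claim is `(1 + ρ) / (1 + ρ ^ 2) ≤ X`, and its `m`-th power is `h`.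
-/
lemma sq_le_flowRadius_one (hρ : 0 < ρ) (hρ1 : ρ < 1) (hX : 1 ≤ X) (hXm : X ^ m = 2 / (1 + ρ))
    (hm : 1 ≤ m) (h : (1 + ρ) ^ (m + 1) ≤ 2 * (1 + ρ ^ 2) ^ m) : ρ ^ 2 ≤ flowRadius ρ X 1 := by
  have hd := flowRadius_denom_pos hρ hρ1 hX hXm hm
  have hle : (1 + ρ) / (1 + ρ ^ 2) ≤ X := by
    refine le_of_pow_le_pow_left₀ (n := m) (by omega) (by linarith) ?_
    rw [hXm, div_pow, div_le_div_iff₀ (by positivity) (by positivity), ← pow_succ]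
    exact h
  rw [div_le_iff₀ (by positivity)] at hle
  rw [flowRadius, sq, pow_one]
  rw [pow_one] at hd
  refine mul_le_mul_of_nonneg_left ?_ hρ.le
  rw [le_div_iff₀ hd]
  linarith

end radii

/-! ### Existence and uniqueness of `ρ⋆` -/

section rhoStar

open Real Set

variable {Λ : ℕ}

/-- The function `log ((1 + x) ^ Λ / (1 + x ^ 2) ^ (Λ - 1))`. -/
noncomputable def logRatio (Λ : ℕ) (x : ℝ) : ℝ := Λ * log (1 + x) - (Λ - 1) * log (1 + x ^ 2)

lemma hasDerivAt_logRatio {x : ℝ} (hx : 0 ≤ x) :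
    HasDerivAt (logRatio Λ) ((Λ - 2 * (Λ - 1) * x - (Λ - 2) * x ^ 2) / ((1 + x) * (1 + x ^ 2)))
      x := by
  have h1 : (1 + x) ≠ 0 := by positivity
  have h2 : (1 + x ^ 2) ≠ 0 := by positivity
  have d1 := (((hasDerivAt_id x).const_add 1).log h1).const_mul (Λ : ℝ)
  have d2 := ((((hasDerivAt_id x).pow 2).const_add 1).log h2).const_mul ((Λ : ℝ) - 1)
  refine (d1.sub d2).congr_deriv ?_
  simp only [id, Pi.pow_apply]
  field_simp
  push_cast
  ring

lemma logRatio_le_log_two_iff (hΛ : 1 ≤ Λ) {x : ℝ} (hx : 0 ≤ x) :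
    logRatio Λ x ≤ log 2 ↔ (1 + x) ^ Λ ≤ 2 * (1 + x ^ 2) ^ (Λ - 1) := by
  rw [← log_le_log_iff (show 0 < (1 + x) ^ Λ by positivity)
    (show 0 < 2 * (1 + x ^ 2) ^ (Λ - 1) by positivity), log_mul two_ne_zero (by positivity),
    log_pow, log_pow, logRatio, Nat.cast_sub hΛ, Nat.cast_one, sub_le_iff_le_add]

lemma logRatio_eq_log_two_iff (hΛ : 1 ≤ Λ) {x : ℝ} (hx : 0 ≤ x) :
    logRatio Λ x = log 2 ↔ (1 + x) ^ Λ = 2 * (1 + x ^ 2) ^ (Λ - 1) := by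
  rw [← log_injOn_pos.eq_iff (show 0 < (1 + x) ^ Λ by positivity)
    (show 0 < 2 * (1 + x ^ 2) ^ (Λ - 1) by positivity),
    log_mul two_ne_zero (by positivity),
    log_pow, log_pow, logRatio, Nat.cast_sub hΛ, Nat.cast_one, sub_eq_iff_eq_add]

/-- `logRatio Λ` increases from `0` to a maximum above `log 2`, and then decreases to `log 2`. -/
lemma exists_logRatio_max (hΛ : 3 ≤ Λ) : ∃ c ∈ Ioo (0 : ℝ) 1,
    StrictMonoOn (logRatio Λ) (Icc 0 c) ∧ ∀ x ∈ Ico c 1, log 2 < logRatio Λ x := by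
  have hL : (3 : ℝ) ≤ Λ := by exact_mod_cast hΛ
  -- The numerator of the derivative; it is strictly decreasing on `[0, ∞)`, so it changes sign
  -- once, at `c`.
  let p : ℝ → ℝ := fun t => Λ - 2 * (Λ - 1) * t - (Λ - 2) * t ^ 2
  have hp : ContinuousOn p (Icc 0 1) := by fun_prop
  have hanti {s t : ℝ} (hs : 0 ≤ s) (hst : s < t) : p t < p s := by
    have : 0 < (t - s) * (2 * (Λ - 1) + (Λ - 2) * (t + s)) :=
      mul_pos (by linarith) (by nlinarith)
    simp only [p]
    linarith
  obtain ⟨c, hc, hpc⟩ := intermediate_value_Ioo' zero_le_one hp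
    (show (0 : ℝ) ∈ Ioo (p 1) (p 0) from ⟨by simp only [p]; linarith, by simp only [p]; linarith⟩)
  have hcont : ∀ x ≥ 0, ContinuousAt (logRatio Λ) x := fun x hx =>
    (hasDerivAt_logRatio hx).continuousAt
  have hden (x : ℝ) (hx : 0 ≤ x) : 0 < (1 + x) * (1 + x ^ 2) := by positivity
  refine ⟨c, hc, strictMonoOn_of_deriv_pos (convex_Icc _ _)
    (fun x hx => (hcont x hx.1).continuousWithinAt) fun x hx => ?_, fun x hx => ?_⟩
  · rw [interior_Icc] at hx
    rw [(hasDerivAt_logRatio hx.1.le).deriv]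
    exact div_pos (hpc ▸ hanti hx.1.le hx.2) (hden x hx.1.le)
  · have hA : StrictAntiOn (logRatio Λ) (Icc c 1) := by
      refine strictAntiOn_of_deriv_neg (convex_Icc _ _)
        (fun x hx => (hcont x (hc.1.le.trans hx.1)).continuousWithinAt) fun x hx => ?_
      rw [interior_Icc] at hx
      have hx0 := hc.1.trans hx.1
      rw [(hasDerivAt_logRatio hx0.le).deriv]
      exact div_neg_of_neg_of_pos (hpc ▸ hanti hc.1.le hx.1) (hden x hx0.le)
    have := hA (Ico_subset_Icc_self hx) (right_mem_Icc.2 hc.2.le) hx.2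
    rwa [(logRatio_eq_log_two_iff (by omega) zero_le_one).2] at this
    obtain ⟨n, rfl⟩ : ∃ n, Λ = n + 1 := ⟨Λ - 1, by omega⟩
    norm_num [pow_succ, mul_comm]

theorem existsUnique_isRhoStar (hΛ : 2 ≤ Λ) : ∃! ρ : ℝ, IsRhoStar Λ ρ := by
  rcases hΛ.eq_or_lt with rfl | hΛ
  · exact ⟨1, Or.inl ⟨rfl, rfl⟩, fun ρ h => by
      rcases h with h | h
      · exact h.2
      · omega⟩
  obtain ⟨c, hc, hmono, hgt⟩ := exists_logRatio_max hΛ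
  have hlog : 0 < log 2 := log_pos one_lt_two
  have hcont : ContinuousOn (logRatio Λ) (Icc 0 c) := fun x hx =>
    (hasDerivAt_logRatio hx.1).continuousAt.continuousWithinAt
  obtain ⟨ρ, hρ, hρe⟩ := intermediate_value_Ioo hc.1.le hcont
    (show log 2 ∈ Ioo _ _ from ⟨by simpa [logRatio] using hlog, hgt c ⟨le_rfl, hc.2⟩⟩)
  refine ⟨ρ, Or.inr ⟨hΛ, hρ.1, hρ.2.trans hc.2,
    (logRatio_eq_log_two_iff (by omega) hρ.1.le).1 hρe⟩, ?_⟩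
  rintro σ (h | ⟨_, h0, h1, h⟩)
  · omega
  rw [← logRatio_eq_log_two_iff (by omega) h0.le] at h
  have hσc : σ < c := not_le.1 fun h' => (hgt σ ⟨h', h1⟩).ne' h
  exact hmono.injOn ⟨h0.le, hσc.le⟩ (Ioo_subset_Icc_self hρ) (h.trans hρe.symm)

/-- For `Λ ≥ 3`, `ρ⋆` lies on the increasing branch of `logRatio`, since beyond `c` the value `log
2` is exceeded. For `Λ = 2` the difference of the two sides is `(ρ - 1) ^ 2`. -/
lemma IsRhoStar.pow_le (hΛ : 2 ≤ Λ) {ρstar ρ : ℝ} (h : IsRhoStar Λ ρstar) (hρ : 0 < ρ)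
    (hle : ρ ≤ ρstar) : (1 + ρ) ^ Λ ≤ 2 * (1 + ρ ^ 2) ^ (Λ - 1) := by
  rcases h with ⟨rfl, rfl⟩ | ⟨hΛ3, h0, h1, h⟩
  · norm_num
    nlinarith [sq_nonneg (ρ - 1)]
  · obtain ⟨c, hc, hmono, hgt⟩ := exists_logRatio_max hΛ3
    rw [← logRatio_eq_log_two_iff (by omega) h0.le] at h
    rw [← logRatio_le_log_two_iff (by omega) hρ.le, ← h]
    have hc' : ρstar < c := not_le.1 fun h' => (hgt _ ⟨h', h1⟩).ne' h
    exact hmono.monotoneOn ⟨hρ.le, hle.trans hc'.le⟩ ⟨h0.le, hc'.le⟩ hle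

end rhoStar

/-! ### Composition of admissible weights -/

section weights

variable {q a b c d : ℂ} {r s t ρ : ℝ}

/-- An edge with weights `a` (if absent) and `b` (if present), for which `1 + b / a` is a point of
the disc of transmissivities of absolute value at most `r`, scaled by a number in `[0, 1]`. -/
def Admissible (q : ℂ) (r : ℝ) (a b : ℂ) : Prop :=
  a ≠ 0 ∧ ∃ σ : ℝ, 0 ≤ σ ∧ σ ≤ 1 ∧ ∃ y : ℂ, ‖y - 1‖ ≤ r * ‖y + (q - 1)‖ ∧ a + b = a * (σ * y)

lemma Admissible.parallel (hq : q ≠ 0) (hr : 0 ≤ r) (ht : 0 ≤ t) (h : Admissible q r a b)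
    (h' : Admissible q s c d)
    (hrs : r + s + (‖q - 1‖ + 1) * (r * s) ≤ t * (1 - ‖q - 1‖ * (r * s))) :
    Admissible q t (a * c) (a * d + b * c + b * d) := by
  obtain ⟨ha, σ, h0, h1, y, hy, hab⟩ := h
  obtain ⟨hc, τ, h0', h1', z, hz, hcd⟩ := h'
  refine ⟨mul_ne_zero ha hc, σ * τ, mul_nonneg h0 h0', mul_le_one₀ h1 h0' h1', y * z,
    transmissivity_mul_le (by simpa using hq) hr ht hy hz hrs, ?_⟩
  push_cast
  linear_combination (c + d) * hab + a * (σ * y) * hcd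

/-- Discs of radius below `ρ` miss `0` and are not closed under scaling, so `σ` is absorbed only
after enlarging the radius to `ρ`. -/
lemma Admissible.exists_transmissivity_le (h : Admissible q r a b) (hr : r ≤ ρ) (hρ : 0 ≤ ρ)
    (hρ1 : ρ ≤ 1) (hρq : ρ * ‖q - 1‖ = 1) :
    ∃ y : ℂ, ‖y - 1‖ ≤ ρ * ‖y + (q - 1)‖ ∧ b = a * (y - 1) := by
  obtain ⟨_, σ, h0, h1, y, hy, hab⟩ := h
  exact ⟨σ * y, transmissivity_real_mul_le hρ hρ1 hρq h0 h1 (hy.trans (by gcongr)),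
    by linear_combination hab⟩

lemma Admissible.series (h : Admissible q r a b) (h' : Admissible q s c d) (hr : r ≤ ρ)
    (hs : s ≤ ρ) (hρ : 0 < ρ) (hρ1 : ρ < 1) (hρq : ρ * ‖q - 1‖ = 1) (hq : q ≠ 0)
    (ht : ρ ^ 2 ≤ t) : Admissible q t (q * (a * c) + a * d + b * c) (b * d) := by
  obtain ⟨y, hy, rfl⟩ := h.exists_transmissivity_le hr hρ.le hρ1.le hρq
  obtain ⟨z, hz, rfl⟩ := h'.exists_transmissivity_le hs hρ.le hρ1.le hρq
  have ha := h.1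
  have hc := h'.1
  have key : ‖(y - 1) * (z - 1)‖ ≤ ρ ^ 2 * ‖(y + (q - 1)) * (z + (q - 1))‖ := by
    rw [norm_mul, norm_mul]
    calc _ ≤ (ρ * ‖y + (q - 1)‖) * (ρ * ‖z + (q - 1)‖) :=
          mul_le_mul hy hz (norm_nonneg _) (by positivity)
      _ = _ := by ring
  have hu {u : ℂ} (hu : ‖u - 1‖ ≤ ρ * ‖u + (q - 1)‖) : u + (q - 1) ≠ 0 := by
    intro h0
    rw [h0, norm_zero, mul_zero] at hu
    have := norm_le_zero_iff.1 hu
    exact hq (by linear_combination h0 - this)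
  -- If this denominator vanished, the product of the two transmissivities would be 1, but it is at
  -- most `ρ ^ 2 < 1`.
  have hne : y + z + (q - 2) ≠ 0 := by
    intro h0
    rw [show (y - 1) * (z - 1) = (y + (q - 1)) * (z + (q - 1)) by
      linear_combination -q * h0] at key
    have hpos := norm_pos_iff.2 (mul_ne_zero (hu hy) (hu hz))
    have := mul_pos (sub_pos.2 (pow_lt_one₀ hρ.le hρ1 two_ne_zero)) hpos
    linarith
  have hdiv : ((y - 1) * (z - 1)) / (y + z + (q - 2)) + 1 + (q - 1) =
      ((y + (q - 1)) * (z + (q - 1))) / (y + z + (q - 2)) := by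
    field_simp
    ring
  refine ⟨?_, 1, zero_le_one, le_rfl, ((y - 1) * (z - 1)) / (y + z + (q - 2)) + 1, ?_, ?_⟩
  · rw [show q * (a * c) + a * (c * (z - 1)) + a * (y - 1) * c = a * c * (y + z + (q - 2)) by ring]
    exact mul_ne_zero (mul_ne_zero ha hc) hne
  · rw [hdiv, add_sub_cancel_right, norm_div, norm_div, ← mul_div_assoc]
    gcongr
    exact key.trans (by gcongr)
  · push_cast
    field_simp
    ring

lemma Admissible.parallel_ne_zero (h : Admissible q r a b) (h' : Admissible q s c d) (hr : r ≤ ρ)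
    (hs : s ≤ ρ) (hρ : 0 < ρ) (hρ1 : ρ < 1) (hρq : ρ * ‖q - 1‖ = 1) (hq : q ≠ 0) :
    q * (a * c) + (a * d + b * c + b * d) ≠ 0 := by
  obtain ⟨y, hy, rfl⟩ := h.exists_transmissivity_le hr hρ.le hρ1.le hρq
  obtain ⟨z, hz, rfl⟩ := h'.exists_transmissivity_le hs hρ.le hρ1.le hρq
  have := mul_add_ne_zero_of_transmissivity (by simpa using hq) hρ hρ1 hρq hy hz
  convert mul_ne_zero (mul_ne_zero h.1 h'.1) this using 1
  ring

end weights

/-! ### The Tutte sum with homogeneous weights -/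

section tutteSum

variable {β : Type*} [DecidableEq β] {κ κ' : Finset β → ℕ} {E : Finset β} {e f : β} {q : ℂ}
  {a b : β → ℂ}

/-- The sum `∑_{A ⊆ E} q ^ κ(A) ∏_{e ∈ A} b_e ∏_{e ∈ E \ A} a_e`. -/
def tutteSum (κ : Finset β → ℕ) (E : Finset β) (q : ℂ) (a b : β → ℂ) : ℂ :=
  ∑ A ∈ E.powerset, q ^ κ A * ((∏ e ∈ A, b e) * ∏ e ∈ E \ A, a e)

lemma tutteSum_insert (he : e ∉ E) :
    tutteSum κ (insert e E) q a b = ∑ A ∈ E.powerset,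
      (q ^ κ A * a e + q ^ κ (insert e A) * b e) * ((∏ e ∈ A, b e) * ∏ e ∈ E \ A, a e) := by
  rw [tutteSum, Finset.sum_powerset_insert he, ← Finset.sum_add_distrib]
  refine Finset.sum_congr rfl fun A hA => ?_
  have heA : e ∉ A := fun h => he (Finset.mem_powerset.1 hA h)
  rw [Finset.insert_sdiff_of_notMem _ heA, Finset.prod_insert (by simp [he]),
    Finset.prod_insert heA, Finset.insert_sdiff_insert, Finset.sdiff_insert_of_notMem he]
  ring

lemma tutteSum_insert_insert (he : e ∉ E) (hf : f ∉ insert e E) :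
    tutteSum κ (insert f (insert e E)) q a b = ∑ A ∈ E.powerset,
      (q ^ κ A * (a e * a f) + q ^ κ (insert e A) * (b e * a f) + q ^ κ (insert f A) * (a e * b f)
        + q ^ κ (insert f (insert e A)) * (b e * b f)) *
      ((∏ e ∈ A, b e) * ∏ e ∈ E \ A, a e) := by
  rw [tutteSum_insert hf, Finset.sum_powerset_insert he, ← Finset.sum_add_distrib]
  refine Finset.sum_congr rfl fun A hA => ?_
  have heA : e ∉ A := fun h => he (Finset.mem_powerset.1 hA h)
  rw [Finset.insert_sdiff_of_notMem _ heA, Finset.prod_insert (by simp [he]),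
    Finset.prod_insert heA, Finset.insert_sdiff_insert, Finset.sdiff_insert_of_notMem he]
  ring

lemma tutteSum_insert_update (he : e ∉ E) (a' b' : ℂ) :
    tutteSum κ (insert e E) q (Function.update a e a') (Function.update b e b') =
      ∑ A ∈ E.powerset, (q ^ κ A * a' + q ^ κ (insert e A) * b') *
        ((∏ e ∈ A, b e) * ∏ e ∈ E \ A, a e) := by
  rw [tutteSum_insert he]
  refine Finset.sum_congr rfl fun A hA => ?_
  have heA : e ∉ A := fun h => he (Finset.mem_powerset.1 hA h)
  rw [Function.update_self, Function.update_self, Finset.prod_update_of_notMem heA,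
    Finset.prod_update_of_notMem (by simp [he])]

lemma tutteSum_parallel (he : e ∉ E) (hf : f ∉ insert e E)
    (h0 : ∀ A ⊆ E, κ' A = κ A) (h1 : ∀ A ⊆ E, κ' (insert e A) = κ (insert e A))
    (h2 : ∀ A ⊆ E, κ' (insert f A) = κ (insert e A))
    (h3 : ∀ A ⊆ E, κ' (insert f (insert e A)) = κ (insert e A)) :
    tutteSum κ' (insert f (insert e E)) q a b =
      tutteSum κ (insert e E) q (Function.update a e (a e * a f))
        (Function.update b e (a e * b f + b e * a f + b e * b f)) := by
  rw [tutteSum_insert_insert he hf, tutteSum_insert_update he]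
  refine Finset.sum_congr rfl fun A hA => ?_
  have hA := Finset.mem_powerset.1 hA
  rw [h0 A hA, h1 A hA, h2 A hA, h3 A hA]
  ring

lemma tutteSum_series (he : e ∉ E) (hf : f ∉ insert e E)
    (h0 : ∀ A ⊆ E, κ' A = κ A + 1) (h1 : ∀ A ⊆ E, κ' (insert e A) = κ A)
    (h2 : ∀ A ⊆ E, κ' (insert f A) = κ A)
    (h3 : ∀ A ⊆ E, κ' (insert f (insert e A)) = κ (insert e A)) :
    tutteSum κ' (insert f (insert e E)) q a b =
      tutteSum κ (insert e E) q (Function.update a e (q * (a e * a f) + a e * b f + b e * a f))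
        (Function.update b e (b e * b f)) := by
  rw [tutteSum_insert_insert he hf, tutteSum_insert_update he]
  refine Finset.sum_congr rfl fun A hA => ?_
  have hA := Finset.mem_powerset.1 hA
  rw [h0 A hA, h1 A hA, h2 A hA, h3 A hA]
  ring

/-- Each absent edge contributes one more component, hence a factor `q`, and the sum factors over
the edges. -/
lemma tutteSum_of_add_card_eq {n : ℕ} (h : ∀ A ⊆ E, κ A + A.card = n) :
    tutteSum κ E q a b = q ^ κ E * ∏ e ∈ E, (q * a e + b e) := by
  simp_rw [add_comm (q * a _)]
  rw [Finset.prod_add, Finset.mul_sum, tutteSum]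
  refine Finset.sum_congr rfl fun A hA => ?_
  have hAE := Finset.mem_powerset.1 hA
  have hκ : κ A = κ E + (E \ A).card := by
    have h1 := h A hAE
    have h2 := h E subset_rfl
    have h3 := Finset.card_sdiff_add_card_eq_card hAE
    omega
  rw [Finset.prod_mul_distrib, Finset.prod_const, hκ, pow_add]
  ring

end tutteSum

/-! ### The induction over series-parallel graphs -/

section seriesParallel

/-- Radii `R k < 1` of discs of transmissivities, for flows `k < Λ`, that are compatible with
parallel composition, and such that a series composition falls into the smallest one. -/
structure RadiusSystem (q : ℂ) (Λ : ℕ) (ρ : ℝ) (R : ℕ → ℝ) : Prop where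
  pos : 0 < ρ
  lt_one : ρ < 1
  mul_norm : ρ * ‖q - 1‖ = 1
  nonneg : ∀ k < Λ, 0 ≤ R k
  le : ∀ k < Λ, R k ≤ ρ
  sq_le : ρ ^ 2 ≤ R 1
  add_le : ∀ k l, k + l < Λ → R k + R l + (‖q - 1‖ + 1) * (R k * R l) ≤
    R (k + l) * (1 - ‖q - 1‖ * (R k * R l))

variable {α β : Type*} {q : ℂ} {Λ : ℕ} {ρ : ℝ} {R : ℕ → ℝ}

lemma RadiusSystem.ne_zero (hR : RadiusSystem q Λ ρ R) : q ≠ 0 := by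
  rintro rfl
  have h1 := hR.mul_norm
  have h2 := hR.lt_one
  norm_num at h1
  linarith

namespace Graph

open Function

variable {G H : Graph α β} {e f : β} {x y w : α} {a b : β → ℂ} {k : β → ℕ}

/-- The edges of `G` have capacities `k` for which all flows are at most `Λ`, and weights `a`
(if absent) and `b` (if present) that are admissible for their capacities, except that edges
that are not bypassed only need to satisfy `q * a + b ≠ 0`. -/
structure IsGoodWeight (G : Graph α β) (q : ℂ) (Λ : ℕ) (R : ℕ → ℝ) (k : β → ℕ) (a b : β → ℂ) :
    Prop where
  one_le : ∀ e ∈ G.edgeSet, 1 ≤ k e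
  flow_le : G.FlowLE k Λ
  ne_zero : ∀ e ∈ G.edgeSet, q * a e + b e ≠ 0
  admissible : ∀ e ∈ G.edgeSet, G.Bypassed e → Admissible q (R (k e)) (a e) (b e)

/-- In `H` the edges `e` and `f` bypass each other, so both are admissible even if the merged edge
is a bridge of `G`. -/
lemma IsGoodWeight.of_parallel [DecidableEq β] [G.Loopless] [H.Loopless]
    (hR : RadiusSystem q Λ ρ R) (h : ParallelData G H e f x y)
    (hw : H.IsGoodWeight q Λ R k a b) :
    G.IsGoodWeight q Λ R (update k e (k e + k f)) (update a e (a e * a f))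
      (update b e (a e * b f + b e * a f + b e * b f)) := by
  have hsub {g : β} (hg : g ∈ G.edgeSet) : g ∈ H.edgeSet := h.edgeSet_eq ▸ Or.inr hg
  have hflow : G.FlowLE (update k e (k e + k f)) Λ := by
    convert FlowLE.of_parallel h hw.flow_le
  have hone : ∀ g ∈ G.edgeSet, 1 ≤ update k e (k e + k f) g := by
    intro g hg
    rcases eq_or_ne g e with rfl | hge
    · rw [update_self]
      exact (hw.one_le g (hsub hg)).trans (Nat.le_add_right _ _)
    · rw [update_of_ne hge]
      exact hw.one_le g (hsub hg)
  have hke := hw.flow_le.capacity_lt hw.one_le h.bypassed_left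
  have hkf := hw.flow_le.capacity_lt hw.one_le h.bypassed_right
  have hadme := hw.admissible e h.link_left.edge_mem h.bypassed_left
  have hadmf := hw.admissible f h.link_right.edge_mem h.bypassed_right
  refine ⟨hone, hflow, fun g hg => ?_, fun g hg hby => ?_⟩
  · rcases eq_or_ne g e with rfl | hge
    · simp only [update_self]
      exact hadme.parallel_ne_zero hadmf (hR.le _ hke) (hR.le _ hkf) hR.pos hR.lt_one
        hR.mul_norm hR.ne_zero
    · simp only [update_of_ne hge]
      exact hw.ne_zero g (hsub hg)
  · rcases eq_or_ne g e with rfl | hge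
    · have hlt := hflow.capacity_lt hone hby
      simp only [update_self] at hlt ⊢
      exact hadme.parallel hR.ne_zero (hR.nonneg _ hke) (hR.nonneg _ hlt) hadmf
        (hR.add_le _ _ hlt)
    · simp only [update_of_ne hge]
      exact hw.admissible g (hsub hg) (h.bypassed_of_ne hby)

lemma IsGoodWeight.of_series [DecidableEq β] [H.Loopless]
    (hR : RadiusSystem q Λ ρ R) (h : SeriesData G H e f x y w)
    (hw : H.IsGoodWeight q Λ R k a b) :
    G.IsGoodWeight q Λ R (update k e 1) (update a e (q * (a e * a f) + a e * b f + b e * a f))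
      (update b e (b e * b f)) := by
  have hsub {g : β} (hg : g ∈ G.edgeSet) : g ∈ H.edgeSet := h.edgeSet_eq ▸ Or.inr hg
  have he := h.link_left.edge_mem
  have hf := h.link_right.edge_mem
  refine ⟨fun g hg => ?_, ?_, fun g hg => ?_, fun g hg hby => ?_⟩
  · rcases eq_or_ne g e with rfl | hge
    · rw [update_self]
    · rw [update_of_ne hge]
      exact hw.one_le g (hsub hg)
  · convert FlowLE.of_series h hw.flow_le (hw.one_le e he) (hw.one_le f hf)
  · rcases eq_or_ne g e with rfl | hge
    · simp only [update_self]
      -- For the merged weights, `q * a + b` is the product of the same expressions for `e` and `f`,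
      -- so bridges need no disc.
      convert mul_ne_zero (hw.ne_zero g he) (hw.ne_zero f hf) using 1
      ring
    · simp only [update_of_ne hge]
      exact hw.ne_zero g (hsub hg)
  · rcases eq_or_ne g e with rfl | hge
    · simp only [update_self]
      have hke := hw.flow_le.capacity_lt hw.one_le (h.bypassed_left hby)
      have hkf := hw.flow_le.capacity_lt hw.one_le (h.bypassed_right hby)
      exact (hw.admissible g he (h.bypassed_left hby)).series
        (hw.admissible f hf (h.bypassed_right hby)) (hR.le _ hke) (hR.le _ hkf) hR.pos hR.lt_one
        hR.mul_norm hR.ne_zero hR.sq_le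
    · simp only [update_of_ne hge]
      exact hw.admissible g (hsub hg) (h.bypassed_of_ne hby hge)

open Classical in
theorem IsSeriesParallel.tutteSum_ne_zero (hR : RadiusSystem q Λ ρ R) (hG : G.IsSeriesParallel)
    (hV : G.vertexSet.Finite) (E : Finset β) (hE : ↑E = G.edgeSet)
    (hw : G.IsGoodWeight q Λ R k a b) :
    tutteSum (fun A => G.numComponents (A : Set β)) E q a b ≠ 0 := by
  induction hG generalizing E k a b with
  | forest G hG =>
    rw [tutteSum_of_add_card_eq (n := G.vertexSet.ncard)]
    · refine mul_ne_zero (pow_ne_zero _ hR.ne_zero) (Finset.prod_ne_zero_iff.2 fun e he => ?_)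
      exact hw.ne_zero e (hE ▸ he)
    · exact fun A hA => hG.numComponents_add_card hV A (hE ▸ Finset.coe_subset.2 hA)
  | parallel G H hG hGH ih =>
    have := hG.loopless
    have := (IsSeriesParallel.parallel G H hG hGH).loopless
    obtain ⟨e, f, x, y, hl, hf, hVH, hL⟩ := hGH
    have h : ParallelData G H e f x y := ⟨hl, hf, hVH, hL⟩
    have heE : e ∈ E := Finset.mem_coe.1 (hE ▸ h.link_left.edge_mem)
    have hfE : f ∈ E.erase e :=
      Finset.mem_erase.2 ⟨h.ne.symm, Finset.mem_coe.1 (hE ▸ h.link_right.edge_mem)⟩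
    obtain ⟨D, rfl, he, hf'⟩ : ∃ D, E = insert f (insert e D) ∧ e ∉ D ∧ f ∉ insert e D := by
      refine ⟨(E.erase e).erase f, ?_, by simp, by simp [h.ne.symm]⟩
      rw [Finset.insert_comm, Finset.insert_erase hfE, Finset.insert_erase heE]
    have hED : (↑(insert e D) : Set β) = G.edgeSet := by
      rw [h.edgeSet_eq, Finset.coe_insert] at hE
      rw [← Set.insert_sdiff_self_of_notMem hf, ← hE,
        Set.insert_sdiff_self_of_notMem (by exact_mod_cast hf')]
    have hmem {A : Finset β} (hA : A ⊆ D) : f ∉ (A : Set β) :=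
      fun h' => hf' (Finset.mem_insert_of_mem (hA h'))
    rw [tutteSum_parallel (κ := fun A => G.numComponents (A : Set β)) he hf']
    · exact ih (hVH ▸ hV) _ hED (hw.of_parallel hR h)
    · exact fun A hA => numComponents_congr hVH fun _ _ _ _ => h.conn_iff_of_notMem (hmem hA)
    · intro A hA
      refine numComponents_congr hVH fun _ _ _ _ => h.conn_iff_of_notMem ?_
      rw [Finset.coe_insert]
      exact fun h' => hmem hA (h'.resolve_left h.ne.symm)
    · intro A hA
      simp only [Finset.coe_insert]
      exact numComponents_congr hVH fun _ _ _ _ => h.conn_insert_iff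
    · intro A hA
      simp only [Finset.coe_insert]
      refine numComponents_congr hVH fun _ _ _ _ => ?_
      rw [h.conn_insert_iff, Set.insert_idem]
  | series G H hG hGH ih =>
    have := (IsSeriesParallel.series G H hG hGH).loopless
    obtain ⟨e, f, x, y, w, hl, hf, hwV, hVH, hL⟩ := hGH
    have h : SeriesData G H e f x y w := ⟨hl, hf, hwV, hVH, hL⟩
    have hVG : G.vertexSet.Finite := hV.subset (hVH ▸ Set.subset_insert _ _)
    have heE : e ∈ E := Finset.mem_coe.1 (hE ▸ h.link_left.edge_mem)
    have hfE : f ∈ E.erase e :=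
      Finset.mem_erase.2 ⟨h.ne.symm, Finset.mem_coe.1 (hE ▸ h.link_right.edge_mem)⟩
    obtain ⟨D, rfl, he, hf'⟩ : ∃ D, E = insert f (insert e D) ∧ e ∉ D ∧ f ∉ insert e D := by
      refine ⟨(E.erase e).erase f, ?_, by simp, by simp [h.ne.symm]⟩
      rw [Finset.insert_comm, Finset.insert_erase hfE, Finset.insert_erase heE]
    have hED : (↑(insert e D) : Set β) = G.edgeSet := by
      rw [h.edgeSet_eq, Finset.coe_insert] at hE
      rw [← Set.insert_sdiff_self_of_notMem hf, ← hE,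
        Set.insert_sdiff_self_of_notMem (by exact_mod_cast hf')]
    have hfA {A : Finset β} (hA : A ⊆ D) : f ∉ (A : Set β) :=
      fun h' => hf' (Finset.mem_insert_of_mem (hA h'))
    have heA {A : Finset β} (hA : A ⊆ D) : e ∉ (A : Set β) := fun h' => he (hA h')
    rw [tutteSum_series (κ := fun A => G.numComponents (A : Set β)) he hf']
    · exact ih hVG _ hED (hw.of_series hR h)
    · exact fun A hA => h.numComponents_of_notMem hVG (heA hA) (hfA hA)
    · intro A hA
      rw [Finset.coe_insert]
      exact h.numComponents_insert_left (heA hA) (hfA hA)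
    · intro A hA
      rw [Finset.coe_insert]
      exact h.numComponents_insert_right (heA hA)
    · intro A hA
      simp only [Finset.coe_insert]
      exact h.numComponents_insert_insert

end Graph

end seriesParallel

/-! ### Assembling the theorem -/

lemma radiusSystem_flowRadius {q : ℂ} {Λ : ℕ} {ρ : ℝ} (hΛ : 2 ≤ Λ) (hρ : 0 < ρ) (hρ1 : ρ < 1)
    (hρq : ρ * ‖q - 1‖ = 1) (h : (1 + ρ) ^ Λ ≤ 2 * (1 + ρ ^ 2) ^ (Λ - 1)) :
    RadiusSystem q Λ ρ (flowRadius ρ ((2 / (1 + ρ)) ^ (1 / ((Λ : ℝ) - 1)))) := by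
  have hΛ' : ((Λ - 1 : ℕ) : ℝ) = (Λ : ℝ) - 1 := by push_cast [Nat.cast_sub (by omega : 1 ≤ Λ)]; rfl
  have hL : (2 : ℝ) ≤ Λ := by exact_mod_cast hΛ
  set X : ℝ := (2 / (1 + ρ)) ^ (1 / ((Λ : ℝ) - 1)) with hXdef
  have hbase : 1 ≤ 2 / (1 + ρ) := by rw [le_div_iff₀ (by linarith)]; linarith
  have hX : 1 ≤ X := Real.one_le_rpow hbase (one_div_nonneg.2 (by linarith))
  have hXm : X ^ (Λ - 1) = 2 / (1 + ρ) := by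
    rw [hXdef, ← Real.rpow_natCast, ← Real.rpow_mul (by positivity), hΛ',
      one_div_mul_cancel (by linarith), Real.rpow_one]
  have hq : ‖q - 1‖ = 1 / ρ := by rw [eq_div_iff hρ.ne', mul_comm, hρq]
  refine ⟨hρ, hρ1, hρq, fun k hk => flowRadius_nonneg hρ hρ1 hX hXm (by omega),
    fun k hk => flowRadius_le hρ hρ1 hX hXm (by omega),
    sq_le_flowRadius_one hρ hρ1 hX hXm (by omega) ?_, fun k l hkl => ?_⟩
  · rwa [Nat.sub_add_cancel (by omega)]
  · rw [hq]
    exact (flowRadius_add hρ hρ1 hX hXm (by omega)).le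

lemma IsRhoStar.pos_and_le_one {Λ : ℕ} {ρ : ℝ} (h : IsRhoStar Λ ρ) : 0 < ρ ∧ ρ ≤ 1 := by
  rcases h with ⟨_, rfl⟩ | ⟨_, h0, h1, _⟩
  exacts [⟨one_pos, le_rfl⟩, ⟨h0, h1.le⟩]

theorem theorem7p1 {α β : Type*} (Λ : ℕ) (hΛ : 2 ≤ Λ) :
    (∃! ρstar : ℝ, IsRhoStar Λ ρstar) ∧
    ∀ ρstar : ℝ, IsRhoStar Λ ρstar →
    ∀ (G : Graph α β) (_hV : G.vertexSet.Finite) (hE : G.edgeSet.Finite),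
      G.Loopless → G.IsSeriesParallel → G.maxmaxflow ≤ (Λ : ℕ∞) →
    ∀ (q : ℂ) (v : β → ℂ),
      1 / ρstar ≤ ‖q - 1‖ → (Λ = 2 → 1 / ρstar < ‖q - 1‖) →
      (∀ e ∈ G.edgeSet, IsRealAntiferromagnetic (v e) ∨
        TransmissivityBound Λ q (v e) (transmissivityRadius Λ (1 / ‖q - 1‖))) →
      G.multivariateTutte hE q v ≠ 0 := by
  refine ⟨existsUnique_isRhoStar hΛ, ?_⟩
  intro ρstar hstar G hV hE _ hSP hflow q v hq hq2 hv
  classical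
  obtain ⟨hs0, hs1⟩ := hstar.pos_and_le_one
  have hq1 : 1 < ‖q - 1‖ := by
    rcases hstar with ⟨h2, rfl⟩ | ⟨_, _, hlt, _⟩
    · simpa using hq2 h2
    · exact (one_lt_one_div hs0 hlt).trans_le hq
  have hq0 : 0 < ‖q - 1‖ := by linarith
  have hρ : 0 < 1 / ‖q - 1‖ := by positivity
  have hρ1 : 1 / ‖q - 1‖ < 1 := (div_lt_one hq0).2 hq1
  have hρs : 1 / ‖q - 1‖ ≤ ρstar := (one_div_le hs0 hq0).1 hq
  have hR := radiusSystem_flowRadius (q := q) hΛ hρ hρ1 (one_div_mul_cancel hq0.ne')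
    (hstar.pow_le hΛ hρ hρs)
  have hrad : transmissivityRadius Λ (1 / ‖q - 1‖) = flowRadius (1 / ‖q - 1‖)
      ((2 / (1 + 1 / ‖q - 1‖)) ^ (1 / ((Λ : ℝ) - 1))) 1 := by
    simp only [transmissivityRadius, flowRadius, pow_one]
  rw [hrad] at hv
  have hZ : G.multivariateTutte hE q v =
      tutteSum (fun A => G.numComponents (A : Set β)) hE.toFinset q (fun _ => 1) v := by
    simp [Graph.multivariateTutte, tutteSum]
  rw [hZ]
  refine hSP.tutteSum_ne_zero hR hV _ hE.coe_toFinset (k := fun _ => 1)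
    ⟨fun _ _ => le_rfl, Graph.flowLE_of_maxmaxflow_le hflow, fun e he => ?_, fun e he _ => ?_⟩
  · rw [mul_one]
    rcases hv e he with ⟨r, hr, h1, h0⟩ | h
    · intro h'
      -- Here `q = -r` would lie in `[0, 1]`, contradicting `1 < ‖q - 1‖`.
      have hqr : q - 1 = ((-r - 1 : ℝ) : ℂ) := by
        push_cast
        rw [← hr]
        linear_combination h'
      rw [hqr, Complex.norm_real, Real.norm_eq_abs] at hq1
      exact hq1.not_ge (abs_le.2 ⟨by linarith, by linarith⟩)
    · exact h.1
  · refine ⟨one_ne_zero, ?_⟩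
    rcases hv e he with ⟨r, hr, h1, h0⟩ | ⟨hne, h, _⟩
    · refine ⟨1 + r, by linarith, by linarith, 1, ?_, by rw [hr]; push_cast; ring⟩
      simpa using mul_nonneg (hR.nonneg 1 hΛ) (norm_nonneg q)
    · refine ⟨1, zero_le_one, le_rfl, 1 + v e, ?_, by push_cast; ring⟩
      rw [norm_div, div_le_iff₀ (norm_pos_iff.2 hne)] at h
      rw [show 1 + v e - 1 = v e by ring, show 1 + v e + (q - 1) = q + v e by ring]
      exact h
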